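/- Conventions. Smooth manifolds are Hausdorff, second countable, without boundary and of a fixed finite dimension (different manifolds may have different dimensions). A simplicial manifold is a simplicial object in the category of smooth manifolds and smooth maps. Germs. For a smooth manifold $S$, let $\mathscr{G}_S$ be the category of germs at $S$. Its objects are pairs $(M,i)$ of a smooth manifold $M$ and a smooth embedding $i\colon S\hookrightarrow M$. A morphism $(M,i)\to(N,j)$ is an equivalence class of smooth maps $f\colon U\to N$ with $f\circ i=j$, defined on open neighbourhoods $U$ of $i(S)$ in $M$; two such maps are equivalent if they agree on an open neighbourhood of $i(S)$ contained in both domains. Composition is induced by composition of maps. A morphism of $\mathscr{G}_S$ is called a cover if it is represented by a submersion defined on an open neighbourhood of $i(S)$. Kan conditions. A Grothendieck singleton pretopology on a category is a class of morphisms (covers) which contains all isomorphisms, is closed under composition, and is such that the pullback of a cover along an arbitrary morphism exists and is a cover. Let $Y$ be a simplicial object in a category $\mathcal{C}$ with such a pretopology. For $n\ge 1$ and $0\le i\le n$, $Y$ satisfies $\mathrm{Kan}(n,i)$ if the horn space $\bigwedge^n_i(Y)$, i.e. the limit of $Y$ weighted by the simplicial set $\bigwedge^n_i\subseteq\Delta^n$,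 exists in $\mathcal{C}$ and the horn projection $p^n_i=d_0\times\cdots\times\widehat{d_i}\times\cdots\times d_n\colon Y_n\to\bigwedge^n_i(Y)$ (the morphism induced by the inclusion $\bigwedge^n_i\subseteq\Delta^n$) is a cover. $Y$ is a Kan simplicial object (an internal $\infty$-groupoid) if it satisfies $\mathrm{Kan}(n,i)$ for all $n\ge1$, $0\le i\le n$. The germ of a simplicial manifold. Let $X$ be a simplicial manifold. The unique iterated degeneracy maps $X_0\to X_n$ are smooth embeddings, and they are preserved by all structure maps of $X$. Hence the manifolds $X_n$ together with these embeddings, and the germs of the structure maps of $X$, form a simplicial object $g(X)$ in $\mathscr{G}_{X_0}$. Theorem. Let $X$ be a simplicial manifold. Then the covers form a Grothendieck singleton pretopology on $\mathscr{G}_{X_0}$, and $g(X)$ is a Kan simplicial object in $\mathscr{G}_{X_0}$ with respect to it. -/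

import Mathlib

open CategoryTheory Opposite TopologicalSpace Topology Simplicial
open scoped Manifold ContDiff

universe v u

/-! ### Smooth manifolds -/

/-- A smooth manifold: Hausdorff, second countable, without boundary, modelled on `ℝ ^ dim`. -/
structure SmoothMfd : Type (u + 1) where
  dim : ℕ
  carrier : Type u
  [topologicalSpace : TopologicalSpace carrier]
  [t2Space : T2Space carrier]
  [secondCountable : SecondCountableTopology carrier]
  [chartedSpace : ChartedSpace (EuclideanSpace ℝ (Fin dim)) carrier]
  [isManifold : IsManifold (𝓡 dim) ∞ carrier]

namespace SmoothMfd

instance : CoeSort SmoothMfd.{u} (Type u) := ⟨SmoothMfd.carrier⟩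

attribute [instance] topologicalSpace t2Space secondCountable chartedSpace isManifold

/-- Smooth maps. -/
structure Hom (M N : SmoothMfd.{u}) : Type u where
  toFun : M → N
  smooth : ContMDiff (𝓡 M.dim) (𝓡 N.dim) ∞ toFun

/-- The category of smooth manifolds and smooth maps. -/
instance : Category.{u} SmoothMfd.{u} where
  Hom M N := Hom M N
  id _ := ⟨id, contMDiff_id⟩
  comp f g := ⟨g.toFun ∘ f.toFun, g.smooth.comp f.smooth⟩

instance (M N : SmoothMfd.{u}) : FunLike (M ⟶ N) M N where
  coe f := f.toFun
  coe_injective := by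
    rintro ⟨f, _⟩ ⟨g, _⟩ h
    congr

theorem smooth {M N : SmoothMfd.{u}} (f : M ⟶ N) : ContMDiff (𝓡 M.dim) (𝓡 N.dim) ∞ f :=
  f.2

theorem hom_ext {M N : SmoothMfd.{u}} {f g : M ⟶ N} (h : ∀ x, f x = g x) : f = g :=
  DFunLike.ext f g h

@[simp] theorem id_apply (M : SmoothMfd.{u}) (x : M) : (𝟙 M : M ⟶ M) x = x := rfl

@[simp] theorem comp_apply {M N P : SmoothMfd.{u}} (f : M ⟶ N) (g : N ⟶ P) (x : M) :
    (f ≫ g) x = g (f x) := rfl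

/-- A smooth embedding: a topological embedding with injective differentials. -/
structure IsEmb {M N : SmoothMfd.{u}} (f : M ⟶ N) : Prop where
  isEmbedding : IsEmbedding f
  injective_mfderiv : ∀ x, Function.Injective (mfderiv (𝓡 M.dim) (𝓡 N.dim) f x)

/-- A smooth map with a smooth left inverse is a smooth embedding. -/
theorem IsEmb.of_leftInverse {M N : SmoothMfd.{u}} (f : M ⟶ N) (r : N ⟶ M)
    (h : f ≫ r = 𝟙 M) : IsEmb f := by
  have h' : Function.LeftInverse r f := fun x => by
    rw [← comp_apply, h, id_apply]
  refine ⟨.of_leftInverse h' (smooth r).continuous (smooth f).continuous, fun x => ?_⟩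
  have hr := (smooth r).mdifferentiable (by simp) (f x)
  have hf := (smooth f).mdifferentiable (by simp) x
  have hc := mfderiv_comp x hr hf
  have e : (r : N → M) ∘ f = id := funext h'
  rw [e, mfderiv_id] at hc
  intro a b hab
  have ha := DFunLike.congr_fun hc a
  have hb := DFunLike.congr_fun hc b
  exact ha.trans ((congrArg (mfderiv (𝓡 N.dim) (𝓡 M.dim) r (f x)) hab).trans hb.symm)

end SmoothMfd

/-! ### Manifolds containing a fixed manifold `S`, and germs at `S` -/

/-- A pair `(M, i)` of a smooth manifold `M` and a smooth embedding `i : S ⟶ M`. -/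
structure MfdEmb (S : SmoothMfd.{u}) : Type (u + 1) where
  mfd : SmoothMfd.{u}
  emb : S ⟶ mfd
  isEmb : SmoothMfd.IsEmb emb

/-- The category of `S`-embeddings; the morphisms are the `S`-preserving smooth maps. -/
instance (S : SmoothMfd.{u}) : Category.{u} (MfdEmb S) where
  Hom A B := { f : A.mfd ⟶ B.mfd // A.emb ≫ f = B.emb }
  id A := ⟨𝟙 _, Category.comp_id _⟩
  comp f g := ⟨f.1 ≫ g.1, by rw [← Category.assoc, f.2, g.2]⟩

/-- An `S`-preserving smooth map to `B` defined on an open neighbourhood of `S` in `A`. -/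
structure GermRep {S : SmoothMfd.{u}} (A B : MfdEmb S) : Type u where
  dom : Opens A.mfd
  mem_dom : ∀ s, A.emb s ∈ dom
  map : dom → B.mfd
  smooth : ContMDiff (𝓡 A.mfd.dim) (𝓡 B.mfd.dim) ∞ map
  map_emb : ∀ s, map ⟨A.emb s, mem_dom s⟩ = B.emb s

namespace GermRep

variable {S : SmoothMfd.{u}}

/-- Two representatives are equivalent if they agree on an open neighbourhood of `S` contained
in the intersection of their domains. -/
instance setoid (A B : MfdEmb S) : Setoid (GermRep A B) where
  r f g := ∃ W : Opens A.mfd, (∀ s, A.emb s ∈ W) ∧ ∃ (hf : W ≤ f.dom) (hg : W ≤ g.dom),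
    ∀ (x : A.mfd) (hx : x ∈ W), f.map ⟨x, hf hx⟩ = g.map ⟨x, hg hx⟩
  iseqv :=
    { refl := fun f => ⟨f.dom, f.mem_dom, le_rfl, le_rfl, fun _ _ => rfl⟩
      symm := by
        rintro f g ⟨W, hW, hf, hg, h⟩
        exact ⟨W, hW, hg, hf, fun x hx => (h x hx).symm⟩
      trans := by
        rintro f g k ⟨W, hW, hf, hg, h⟩ ⟨W', hW', hg', hk, h'⟩
        exact ⟨W ⊓ W', fun s => ⟨hW s, hW' s⟩, fun _ hx => hf hx.1, fun _ hx => hk hx.2,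
          fun x hx => (h x hx.1).trans (h' x hx.2)⟩ }

/-- A globally defined `S`-preserving map, as a representative. -/
def ofHom {A B : MfdEmb S} (f : A ⟶ B) : GermRep A B where
  dom := ⊤
  mem_dom _ := trivial
  map x := f.1 x.1
  smooth := (SmoothMfd.smooth f.1).comp contMDiff_subtype_val
  map_emb s := DFunLike.congr_fun f.2 s

/-- The domain of a composition: the points of the domain of `f` that `f` sends into the
domain of `g`. -/
def compDom {A B C : MfdEmb S} (f : GermRep A B) (g : GermRep B C) : Opens A.mfd where
  carrier := { x | ∃ hx : x ∈ f.dom, f.map ⟨x, hx⟩ ∈ g.dom }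
  is_open' := by
    have h : IsOpen (f.map ⁻¹' g.dom) := g.dom.isOpen.preimage f.smooth.continuous
    have h' := f.dom.isOpen.isOpenMap_subtype_val _ h
    convert h' using 1
    ext x
    simp

/-- Composition of representatives. -/
def comp {A B C : MfdEmb S} (f : GermRep A B) (g : GermRep B C) : GermRep A C where
  dom := f.compDom g
  mem_dom s := ⟨f.mem_dom s, by
    rw [f.map_emb s]
    exact g.mem_dom s⟩
  map x := g.map ⟨f.map ⟨x.1, x.2.1⟩, x.2.2⟩
  smooth := by
    have h1 : ContMDiff (𝓡 A.mfd.dim) (𝓡 B.mfd.dim) ∞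
        (fun x : f.compDom g => f.map ⟨x.1, x.2.1⟩) :=
      f.smooth.comp (contMDiff_inclusion (fun _ hx => hx.1 : f.compDom g ≤ f.dom))
    exact g.smooth.comp ((ContMDiff.subtypeVal_comp_iff g.dom
      (fun x : f.compDom g => ⟨f.map ⟨x.1, x.2.1⟩, x.2.2⟩)).1 h1)
  map_emb s := by
    rw [← g.map_emb s]
    exact congrArg g.map (Subtype.ext (f.map_emb s))

theorem equiv_of_map_eq {A B : MfdEmb S} (f g : GermRep A B)
    (h : ∀ x hf hg, f.map ⟨x, hf⟩ = g.map ⟨x, hg⟩) : f ≈ g :=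
  ⟨f.dom ⊓ g.dom, fun s => ⟨f.mem_dom s, g.mem_dom s⟩, inf_le_left, inf_le_right,
    fun x hx => h x hx.1 hx.2⟩

theorem comp_equiv {A B C : MfdEmb S} {f f' : GermRep A B} {g g' : GermRep B C}
    (hf : f ≈ f') (hg : g ≈ g') : f.comp g ≈ f'.comp g' := by
  obtain ⟨W, hW, hWf, hWf', h⟩ := hf
  obtain ⟨V, hV, hVg, hVg', k⟩ := hg
  let r : GermRep A B := ⟨W, hW, fun x => f.map ⟨x.1, hWf x.2⟩,
    f.smooth.comp (contMDiff_inclusion hWf), fun s => f.map_emb s⟩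
  let t : GermRep B C := ⟨V, hV, fun x => g.map ⟨x.1, hVg x.2⟩,
    g.smooth.comp (contMDiff_inclusion hVg), fun s => g.map_emb s⟩
  refine ⟨(r.comp t).dom, (r.comp t).mem_dom, fun x hx => ⟨hWf hx.1, hVg hx.2⟩,
    fun x hx => ⟨hWf' hx.1, ?_⟩, fun x hx => ?_⟩
  · rw [← h x hx.1]
    exact hVg' hx.2
  · exact (k _ hx.2).trans (congrArg g'.map (Subtype.ext (h x hx.1)))

end GermRep

/-- The objects of the category of germs at `S`: the same pairs `(M, i)`. -/
structure GermCat (S : SmoothMfd.{u}) : Type (u + 1) where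
  toEmb : MfdEmb S

/-- The category of germs at `S`: morphisms are equivalence classes of `S`-preserving smooth maps
defined on open neighbourhoods of `S`. -/
instance (S : SmoothMfd.{u}) : Category.{u} (GermCat S) where
  Hom A B := Quotient (GermRep.setoid A.toEmb B.toEmb)
  id A := Quotient.mk _ (GermRep.ofHom (𝟙 A.toEmb))
  comp := Quotient.map₂ GermRep.comp fun _ _ hf _ _ hg => GermRep.comp_equiv hf hg
  id_comp := by
    rintro A B ⟨f⟩
    exact Quotient.sound (GermRep.equiv_of_map_eq _ _ fun _ _ _ => rfl)
  comp_id := by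
    rintro A B ⟨f⟩
    exact Quotient.sound (GermRep.equiv_of_map_eq _ _ fun _ _ _ => rfl)
  assoc := by
    rintro A B C D ⟨f⟩ ⟨g⟩ ⟨h⟩
    exact Quotient.sound (GermRep.equiv_of_map_eq _ _ fun _ _ _ => rfl)

/-- The germ of a representative. -/
def GermRep.germ {S : SmoothMfd.{u}} {A B : GermCat S} (f : GermRep A.toEmb B.toEmb) : A ⟶ B :=
  Quotient.mk _ f

/-- The functor sending an `S`-preserving smooth map to its germ. -/
def germFunctor (S : SmoothMfd.{u}) : MfdEmb S ⥤ GermCat S where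
  obj A := ⟨A⟩
  map f := (GermRep.ofHom f).germ
  map_id _ := rfl
  map_comp _ _ := Quotient.sound (GermRep.equiv_of_map_eq _ _ fun _ _ _ => rfl)

/-- The covers of the category of germs at `S`: the morphisms represented by a submersion defined
on an open neighbourhood of `S`. -/
def submersionGerms (S : SmoothMfd.{u}) : MorphismProperty (GermCat S) :=
  fun A B φ => ∃ f : GermRep A.toEmb B.toEmb, f.germ = φ ∧
    ∀ x, Function.Surjective (mfderiv (𝓡 A.toEmb.mfd.dim) (𝓡 B.toEmb.mfd.dim) f.map x)

/-! ### Pretopologies and Kan conditions -/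

section Kan

variable {C : Type u} [Category.{v} C]

/-- The class `T` of morphisms is (the class of covers of) a Grothendieck singleton
pretopology. -/
structure IsSingletonPretopology (T : MorphismProperty C) : Prop where
  hasPullback : ∀ {X Y U : C} (f : Y ⟶ X) (p : U ⟶ X), T p → Limits.HasPullback f p
  baseChange : ∀ {X Y U P : C} {f : Y ⟶ X} {p : U ⟶ X} {q : P ⟶ Y} {g : P ⟶ U},
    IsPullback q g f p → T p → T q
  comp : ∀ {X Y Z : C} (f : X ⟶ Y) (g : Y ⟶ Z), T f → T g → T (f ≫ g)
  iso : ∀ {X Y : C} (f : X ⟶ Y), IsIso f → T f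

/-- The weighted cone over `X` for the horn `Λ[n, i]` with point `X _⦋n⦌`, given by the
restriction along `Λ[n, i] ⊆ Δ[n]`. -/
def hornCone (X : SimplicialObject C) (n : ℕ) (i : Fin (n + 1)) :
    Limits.WeightedCone (Λ[n, i] : SSet.{0}) X :=
  Limits.WeightedCone.mk (X _⦋n⦌) (fun _ x => X.map (SSet.stdSimplex.objEquiv x.1).op) <| by
    intro j₁ j₂ x f
    rw [← X.map_comp]
    rfl

/-- The components of `hornCone` at the nondegenerate `n`-simplices of the horn are the faces:
the induced map to the horn space is `d₀ × ⋯ × d̂ᵢ × ⋯ × dₙ₊₁`. -/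
theorem hornCone_face (X : SimplicialObject C) (n : ℕ) (i j : Fin (n + 2)) (h : j ≠ i) :
    (hornCone X (n + 1) i).π (SSet.horn.face i j h) = X.δ j := rfl

/-- The Kan condition `Kan(n, i)` with respect to the class of covers `T`: the horn space, that is
the limit of `X` weighted by the horn `Λ[n, i]`, exists, and the horn projection from `X _⦋n⦌`
is a cover. -/
def KanCondition (T : MorphismProperty C) (X : SimplicialObject C) (n : ℕ) (i : Fin (n + 1)) :
    Prop :=
  ∃ (c : Limits.WeightedCone (Λ[n, i] : SSet.{0}) X) (hc : c.IsLimit),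
    T (Limits.IsLimit.lift hc (hornCone X n i))

/-- Kan simplicial objects, or internal `∞`-groupoids. -/
def IsKanObject (T : MorphismProperty C) (X : SimplicialObject C) : Prop :=
  ∀ (n : ℕ), 1 ≤ n → ∀ i : Fin (n + 1), KanCondition T X n i

end Kan

/-! ### The germ of a simplicial manifold -/

/-- Simplicial manifolds. -/
abbrev SimplicialMfd := SimplicialObject SmoothMfd.{u}

namespace SimplicialMfd

variable (X : SimplicialMfd.{u})

/-- The (unique) iterated degeneracy map `X₀ ⟶ Xₖ`. -/
def baseMap (k : SimplexCategoryᵒᵖ) : X _⦋0⦌ ⟶ X.obj k :=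
  X.map (SimplexCategory.const k.unop ⦋0⦌ 0).op

theorem baseMap_map {k l : SimplexCategoryᵒᵖ} (f : k ⟶ l) :
    X.baseMap k ≫ X.map f = X.baseMap l := by
  rw [baseMap, ← X.map_comp]
  congr 1

theorem baseMap_isEmb (k : SimplexCategoryᵒᵖ) : SmoothMfd.IsEmb (X.baseMap k) := by
  refine SmoothMfd.IsEmb.of_leftInverse _ (X.map (SimplexCategory.const ⦋0⦌ k.unop 0).op) ?_
  rw [baseMap, ← X.map_comp, ← X.map_id]
  exact congrArg X.map (Quiver.Hom.unop_inj (Subsingleton.elim _ _))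

/-- A simplicial manifold as a simplicial object in the category of `X₀`-embeddings. -/
def overBase : SimplicialObject (MfdEmb (X _⦋0⦌)) where
  obj k := ⟨X.obj k, X.baseMap k, X.baseMap_isEmb k⟩
  map f := ⟨X.map f, X.baseMap_map f⟩
  map_id k := Subtype.ext (X.map_id k)
  map_comp f g := Subtype.ext (X.map_comp f g)

/-- The germ of a simplicial manifold at its base space: the simplicial object `g(X)` in the
category of germs at `X₀`. -/
def germ : SimplicialObject (GermCat (X _⦋0⦌)) :=
  X.overBase ⋙ germFunctor (X _⦋0⦌)

end SimplicialMfd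

/-! A germ has a tangent map at each point of S. As surjectivity of a differential is an open
condition, a germ is a cover exactly when its tangent maps at the points of S are surjective
(`GermCat.submersionGerms_iff`). Closure of covers under composition and isomorphisms is then linear
algebra. Pullbacks and horn spaces remain; both are solution spaces, near S, of finite systems of
equations between germs.

Such a system has a solution manifold with the expected tangent spaces if the kernels of the
linearized equations have constant dimension along S and the system is regular at each point
(`GermSystem.nonempty_universalSolution`). Regularity has two forms. If the linearized equations are
independent, the implicit function theorem applies; this gives pullbacks along covers. Horn
equations are in general dependent. For them, every solution of the linearized equations is the
velocity of a family of true solutions. A maximal independent subsystem cuts out a submanifold with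
the kernel as tangent space; by the inverse function theorem the family fills a neighbourhood in it,
so the other equations hold there too (`exists_slice`).

For a horn, the family consists of the simplices of one dimension more, with their faces. The
tangent spaces at a point of S form a simplicial vector space, in which Moore's argument fills every
horn (`FaceSystem.exists_filler`). This one fact yields both regularity of the horn equations and
surjectivity of the tangent maps of the horn projection. The horn's tangent space has dimension dim
Yₘ₊₁ minus that of the common kernel of all faces but one, and the latter depends only on the
dimensions of the Yₙ (`FaceSystem.finrank_K_eq`), hence not on the point.

The argument applies to every simplicial object of the germ category. Empty S is treated separately:
all germs between two objects then coincide. -/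

/-! ### Derivatives of maps between smooth manifolds -/

/-- The Euclidean space of dimension `n`. -/
abbrev Euc (n : ℕ) := EuclideanSpace ℝ (Fin n)

/-- The interior of a predicate. -/
theorem exists_opens_interior {X : Type*} [TopologicalSpace X] (P : X → Prop) :
    ∃ U : Opens X, (∀ x ∈ U, P x) ∧ ∀ x, (∀ᶠ y in 𝓝 x, P y) → x ∈ U :=
  ⟨⟨interior {x | P x}, isOpen_interior⟩, fun _ hx => interior_subset (s := {x | P x}) hx,
    fun _ hx => mem_interior_iff_mem_nhds.2 hx⟩

/-- In finite dimension, surjectivity of a continuous linear map is an open condition. -/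
theorem ContinuousLinearMap.eventually_surjective {E F : Type*} [NormedAddCommGroup E]
    [NormedSpace ℝ E] [NormedAddCommGroup F] [NormedSpace ℝ F] [FiniteDimensional ℝ F]
    (A : E →L[ℝ] F) (hA : Function.Surjective A) :
    ∀ᶠ B : E →L[ℝ] F in 𝓝 A, Function.Surjective B := by
  -- With σ a section of A, the map B ∘ σ is close to 1 for B close to A, hence invertible, which
  -- forces B to be surjective.
  obtain ⟨σ, hσ⟩ := A.toLinearMap.exists_rightInverse_of_surjective (LinearMap.range_eq_top.2 hA)
  let σ' : F →L[ℝ] E := LinearMap.toContinuousLinearMap σ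
  have h1 : A.comp σ' = 1 := by
    ext x
    exact LinearMap.congr_fun hσ x
  have hc : Continuous fun B : E →L[ℝ] F => B.comp σ' := by fun_prop
  have : CompleteSpace F := FiniteDimensional.complete ℝ F
  filter_upwards [((Units.isOpen (R := F →L[ℝ] F)).preimage hc).mem_nhds
    (show IsUnit (A.comp σ') from h1 ▸ isUnit_one)] with B hB
  have h2 : Function.Surjective (B.comp σ') := (ContinuousLinearMap.isUnit_iff_bijective.1 hB).2
  exact Function.Surjective.of_comp h2

namespace SmoothMfd

/-- The derivative of a map between smooth manifolds, in the preferred charts. -/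
noncomputable def deriv {M N : SmoothMfd.{u}} (f : M → N) (x : M) : Euc M.dim →L[ℝ] Euc N.dim :=
  mfderiv (𝓡 M.dim) (𝓡 N.dim) f x

theorem deriv_congr {M N : SmoothMfd.{u}} {f g : M → N} {x : M} (h : f =ᶠ[𝓝 x] g) :
    deriv f x = deriv g x :=
  h.mfderiv_eq

theorem deriv_comp {M N P : SmoothMfd.{u}} {f : M → N} {g : N → P} (x : M)
    (hg : MDifferentiableAt (𝓡 N.dim) (𝓡 P.dim) g (f x))
    (hf : MDifferentiableAt (𝓡 M.dim) (𝓡 N.dim) f x) :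
    deriv (g ∘ f) x = (deriv g (f x)).comp (deriv f x) :=
  mfderiv_comp x hg hf

theorem deriv_id {M : SmoothMfd.{u}} (x : M) : deriv (id : M → M) x = ContinuousLinearMap.id ℝ _ :=
  mfderiv_id

/-- The points at which a smooth map is a submersion form an open set. -/
theorem eventually_surjective_deriv {M N : SmoothMfd.{u}} {f : M → N} {x : M}
    (hf : ContMDiffAt (𝓡 M.dim) (𝓡 N.dim) ∞ f x) (h : Function.Surjective (deriv f x)) :
    ∀ᶠ y in 𝓝 x, Function.Surjective (deriv f y) := by
  set φ := extChartAt (𝓡 M.dim) x with hφ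
  set ψ := extChartAt (𝓡 N.dim) (f x) with hψ
  let F : Euc M.dim → Euc N.dim := fun z => ψ (f (φ.symm z))
  have hF : ContDiffAt ℝ ∞ F (φ x) := by
    have := (contMDiffAt_iff.1 hf).2
    rw [ModelWithCorners.range_eq_univ, contDiffWithinAt_univ] at this
    exact this
  have hd : deriv f x = fderiv ℝ F (φ x) := by
    rw [deriv, (hf.mdifferentiableAt (by simp)).mfderiv, ModelWithCorners.range_eq_univ,
      fderivWithin_univ]
    rfl
  have hφc : ContinuousAt φ x := continuousAt_extChartAt x
  have hFc : ContinuousAt (fderiv ℝ F) (φ x) :=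
    (hF.fderiv_right (m := 0) (by norm_num)).continuousAt
  rw [hd] at h
  have h1 : ∀ᶠ y in 𝓝 x, Function.Surjective (fderiv ℝ F (φ y)) :=
    (hFc.comp hφc).eventually ((fderiv ℝ F (φ x)).eventually_surjective h)
  have h2 : ∀ᶠ y in 𝓝 x, ContMDiffAt (𝓡 M.dim) (𝓡 N.dim) 1 f y :=
    (contMDiffAt_iff_contMDiffAt_nhds (by simp)).1
      (hf.of_le (by norm_num : (1 : ℕ∞ω) ≤ ∞))
  have h3 : ∀ᶠ y in 𝓝 x, ContDiffAt ℝ 1 F (φ y) :=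
    hφc.eventually ((hF.of_le (by norm_num : (1 : ℕ∞ω) ≤ ∞)).eventually (by simp))
  have h4 : ∀ᶠ y in 𝓝 x, y ∈ (chartAt (Euc M.dim) x).source :=
    (chartAt (Euc M.dim) x).open_source.mem_nhds (mem_chart_source _ x)
  have h5 : ∀ᶠ y in 𝓝 x, f y ∈ (chartAt (Euc N.dim) (f x)).source :=
    hf.continuousAt.eventually
      ((chartAt (Euc N.dim) (f x)).open_source.mem_nhds (mem_chart_source _ (f x)))
  filter_upwards [h1, h2, h3, h4.eventually_nhds, h5] with y hy1 hy2 hy3 hy4 hy5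
  have e : ψ ∘ f =ᶠ[𝓝 y] F ∘ φ := by
    filter_upwards [hy4] with z hz
    simp only [Function.comp, F]
    rw [φ.left_inv (by simpa [hφ] using hz)]
  have hy4' := hy4.self_of_nhds
  -- `deriv f y` refers to the preferred charts at y and f y, while F is written in the charts φ, ψ
  -- fixed at x. The two differ by the derivatives of φ and ψ, which are invertible.
  have hψd := mdifferentiableAt_extChartAt (I := 𝓡 N.dim) hy5
  have hφd := mdifferentiableAt_extChartAt (I := 𝓡 M.dim) hy4'
  have k1 := mfderiv_comp y hψd (hy2.mdifferentiableAt (by simp))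
  have k2 := mfderiv_comp (I' := 𝓘(ℝ, Euc M.dim)) (I'' := 𝓘(ℝ, Euc N.dim)) (g := F) y
    (hy3.differentiableAt (by simp)).mdifferentiableAt hφd
  rw [← hψ, e.mfderiv_eq, k2, mfderiv_eq_fderiv] at k1
  intro w
  obtain ⟨v, hv⟩ := hy1 (mfderiv (𝓡 N.dim) 𝓘(ℝ, Euc N.dim) ψ (f y) w)
  obtain ⟨v', hv'⟩ := (isInvertible_mfderiv_extChartAt (I := 𝓡 M.dim) (x := x)
    (by simpa using hy4')).bijective.2 v
  refine ⟨v', (isInvertible_mfderiv_extChartAt (I := 𝓡 N.dim) (x := f x)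
    (by simpa using hy5)).bijective.1 ?_⟩
  have k3 := DFunLike.congr_fun k1 v'
  refine k3.symm.trans ?_
  rw [← hv]
  exact congrArg _ hv'

end SmoothMfd

/-! ### Total extensions of representatives and the tangent maps of germs -/

namespace GermRep

variable {S : SmoothMfd.{u}} {A B C : MfdEmb S}

/-- The representative given by a map that is smooth on an open neighbourhood `U` of `S`. -/
def ofSmoothOn (f : A.mfd → B.mfd) (U : Opens A.mfd) (hU : ∀ s, A.emb s ∈ U)
    (hf : ∀ x ∈ U, ContMDiffAt (𝓡 A.mfd.dim) (𝓡 B.mfd.dim) ∞ f x)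
    (h : ∀ s, f (A.emb s) = B.emb s) : GermRep A B where
  dom := U
  mem_dom := hU
  map x := f x
  smooth x := contMDiffAt_subtype_iff.2 (hf x x.2)
  map_emb := h

theorem dom_mem_nhds (f : GermRep A B) {x : A.mfd} (h : x ∈ f.dom) :
    ∀ᶠ y in 𝓝 x, y ∈ f.dom :=
  f.dom.isOpen.mem_nhds h

variable [Nonempty S.carrier]

open Classical in
/-- An extension of a representative to a map defined everywhere. -/
noncomputable def ext (f : GermRep A B) : A.mfd → B.mfd := fun x =>
  if h : x ∈ f.dom then f.map ⟨x, h⟩ else B.emb (Classical.arbitrary S.carrier)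

theorem ext_apply (f : GermRep A B) {x : A.mfd} (h : x ∈ f.dom) : f.ext x = f.map ⟨x, h⟩ :=
  dif_pos h

@[simp] theorem ext_emb (f : GermRep A B) (s : S) : f.ext (A.emb s) = B.emb s := by
  rw [f.ext_apply (f.mem_dom s), f.map_emb]

theorem contMDiffAt_ext (f : GermRep A B) {x : A.mfd} (h : x ∈ f.dom) :
    ContMDiffAt (𝓡 A.mfd.dim) (𝓡 B.mfd.dim) ∞ f.ext x := by
  have h1 : (fun y : f.dom => f.ext y) = f.map := funext fun y => f.ext_apply y.2
  have h2 := f.smooth ⟨x, h⟩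
  rw [← h1] at h2
  exact contMDiffAt_subtype_iff.1 h2

theorem mdifferentiableAt_ext (f : GermRep A B) {x : A.mfd} (h : x ∈ f.dom) :
    MDifferentiableAt (𝓡 A.mfd.dim) (𝓡 B.mfd.dim) f.ext x :=
  (f.contMDiffAt_ext h).mdifferentiableAt (by simp)

theorem ext_ofSmoothOn (f : A.mfd → B.mfd) (U : Opens A.mfd) (hU hf h) (s : S) :
    (ofSmoothOn (B := B) f U hU hf h).ext =ᶠ[𝓝 (A.emb s)] f := by
  filter_upwards [U.isOpen.mem_nhds (hU s)] with x hx
  exact ext_apply (ofSmoothOn f U hU hf h) hx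

theorem ext_ofHom (f : A ⟶ B) : (ofHom f).ext = f.1 :=
  funext fun _ => ext_apply (ofHom f) trivial

theorem ext_comp (f : GermRep A B) (g : GermRep B C) (s : S) :
    (f.comp g).ext =ᶠ[𝓝 (A.emb s)] g.ext ∘ f.ext := by
  filter_upwards [(f.comp g).dom_mem_nhds ((f.comp g).mem_dom s)] with x hx
  rw [ext_apply _ hx, Function.comp, f.ext_apply hx.1, g.ext_apply hx.2]
  rfl

/-- Neighbourhoods of the single points of S on which two maps agree unite to a neighbourhood of S,
so equality of germs can be tested point by point. -/
theorem equiv_iff (f g : GermRep A B) :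
    f ≈ g ↔ ∀ s, f.ext =ᶠ[𝓝 (A.emb s)] g.ext := by
  constructor
  · rintro ⟨W, hW, hf, hg, h⟩ s
    filter_upwards [W.isOpen.mem_nhds (hW s)] with x hx
    rw [f.ext_apply (hf hx), g.ext_apply (hg hx), h x hx]
  · intro h
    obtain ⟨W, hW, hW'⟩ := exists_opens_interior
      fun x => x ∈ f.dom ∧ x ∈ g.dom ∧ f.ext x = g.ext x
    refine ⟨W, fun s => hW' _ ?_, fun x hx => (hW x hx).1, fun x hx => (hW x hx).2.1,
      fun x hx => ?_⟩
    · exact (f.dom_mem_nhds (f.mem_dom s)).and ((g.dom_mem_nhds (g.mem_dom s)).and (h s))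
    · rw [← f.ext_apply, ← g.ext_apply, (hW x hx).2.2]

theorem surjective_mfderiv_map_iff (f : GermRep A B) {x : A.mfd} (h : x ∈ f.dom) :
    Function.Surjective (mfderiv (𝓡 A.mfd.dim) (𝓡 B.mfd.dim) f.map ⟨x, h⟩) ↔
      Function.Surjective (SmoothMfd.deriv f.ext x) := by
  classical
  have hv : MDifferentiableAt (𝓡 A.mfd.dim) (𝓡 A.mfd.dim) (Subtype.val : f.dom → A.mfd) ⟨x, h⟩ :=
    contMDiff_subtype_val.mdifferentiable (n := ∞) (by simp) _
  have h1 : f.ext ∘ Subtype.val = f.map := funext fun y => f.ext_apply y.2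
  have h2 := mfderiv_comp (I := 𝓡 A.mfd.dim) (I' := 𝓡 A.mfd.dim) (I'' := 𝓡 B.mfd.dim)
    (⟨x, h⟩ : f.dom) (f.mdifferentiableAt_ext h) hv
  rw [h1] at h2
  -- A local inverse of the inclusion of the domain; its derivative lifts tangent vectors of A to
  -- the domain. Its values off the domain are immaterial.
  let r : A.mfd → f.dom := fun y => if hy : y ∈ f.dom then ⟨y, hy⟩ else ⟨x, h⟩
  have hr : ∀ᶠ y in 𝓝 x, (r y : A.mfd) = y := by
    filter_upwards [f.dom_mem_nhds h] with y hy
    simp [r, hy]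
  have hrx : r x = ⟨x, h⟩ := by simp [r, h]
  have hrd : ContMDiffAt (𝓡 A.mfd.dim) (𝓡 A.mfd.dim) ∞ r x :=
    (ContMDiffAt.subtypeVal_comp_iff f.dom r x).1 (contMDiffAt_id.congr_of_eventuallyEq hr)
  have h3 := mfderiv_comp_of_eq (I := 𝓡 A.mfd.dim) (I' := 𝓡 A.mfd.dim) (I'' := 𝓡 A.mfd.dim)
    hv (hrd.mdifferentiableAt (by simp)) hrx
  have h4 : mfderiv (𝓡 A.mfd.dim) (𝓡 A.mfd.dim) (Subtype.val ∘ r) x =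
      ContinuousLinearMap.id ℝ _ := by
    exact (Filter.EventuallyEq.mfderiv_eq (f := id) hr).trans mfderiv_id
  constructor
  · intro hs
    rw [h2] at hs
    exact Function.Surjective.of_comp hs
  · intro hs w
    obtain ⟨v, hv⟩ := hs w
    rw [h4] at h3
    rw [hrx] at h3
    refine ⟨mfderiv (𝓡 A.mfd.dim) (𝓡 A.mfd.dim) r x v, ?_⟩
    rw [h2]
    refine Eq.trans ?_ hv
    exact congrArg (SmoothMfd.deriv f.ext x) (DFunLike.congr_fun h3 v).symm

end GermRep

namespace GermCat

variable {S : SmoothMfd.{u}} {A B C : GermCat S}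

/-- The dimension of the manifold underlying an object of the category of germs. -/
abbrev dim (A : GermCat S) : ℕ := A.toEmb.mfd.dim

theorem exists_rep (φ : A ⟶ B) : ∃ f : GermRep A.toEmb B.toEmb, f.germ = φ :=
  Quotient.exists_rep φ

theorem germ_comp (f : GermRep A.toEmb B.toEmb) (g : GermRep B.toEmb C.toEmb) :
    (f.germ : A ⟶ B) ≫ (g.germ : B ⟶ C) = (f.comp g).germ := rfl

variable [Nonempty S.carrier]

/-- The tangent map of a germ at a point of `S`. -/
noncomputable def tangent (s : S) (φ : A ⟶ B) : Euc A.dim →L[ℝ] Euc B.dim :=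
  Quotient.lift (fun f : GermRep A.toEmb B.toEmb => SmoothMfd.deriv f.ext (A.toEmb.emb s))
    (fun f g h => SmoothMfd.deriv_congr ((GermRep.equiv_iff f g).1 h s)) φ

theorem tangent_germ (s : S) (f : GermRep A.toEmb B.toEmb) :
    tangent s (GermRep.germ f : A ⟶ B) = SmoothMfd.deriv f.ext (A.toEmb.emb s) := rfl

theorem germ_eq_iff (f g : GermRep A.toEmb B.toEmb) :
    (f.germ : A ⟶ B) = g.germ ↔ ∀ s, f.ext =ᶠ[𝓝 (A.toEmb.emb s)] g.ext :=
  Quotient.eq.trans (GermRep.equiv_iff f g)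

@[simp] theorem tangent_id (s : S) : tangent s (𝟙 A) = ContinuousLinearMap.id ℝ _ := by
  refine (tangent_germ s (GermRep.ofHom (𝟙 A.toEmb))).trans ?_
  rw [GermRep.ext_ofHom]
  exact SmoothMfd.deriv_id _

@[simp] theorem tangent_comp (s : S) (φ : A ⟶ B) (ψ : B ⟶ C) :
    tangent s (φ ≫ ψ) = (tangent s ψ).comp (tangent s φ) := by
  obtain ⟨f, rfl⟩ := exists_rep φ
  obtain ⟨g, rfl⟩ := exists_rep ψ
  rw [germ_comp, tangent_germ, SmoothMfd.deriv_congr (f.ext_comp g s), SmoothMfd.deriv_comp _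
    (by rw [f.ext_emb]; exact g.mdifferentiableAt_ext (g.mem_dom s))
    (f.mdifferentiableAt_ext (f.mem_dom s)), f.ext_emb]
  rfl

/-- A germ is a cover if and only if its tangent maps at the points of `S` are surjective. -/
theorem submersionGerms_iff (φ : A ⟶ B) :
    submersionGerms S φ ↔ ∀ s, Function.Surjective (tangent s φ) := by
  constructor
  · rintro ⟨f, rfl, hf⟩ s
    exact (f.surjective_mfderiv_map_iff (f.mem_dom s)).1 (hf _)
  · intro h
    obtain ⟨f, rfl⟩ := exists_rep φ
    obtain ⟨U, hU, hU'⟩ := exists_opens_interior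
      fun x => x ∈ f.dom ∧ Function.Surjective (SmoothMfd.deriv f.ext x)
    let g : GermRep A.toEmb B.toEmb := GermRep.ofSmoothOn f.ext U
      (fun s => hU' _ ((f.dom_mem_nhds (f.mem_dom s)).and
        (SmoothMfd.eventually_surjective_deriv (f.contMDiffAt_ext (f.mem_dom s)) (h s))))
      (fun x hx => f.contMDiffAt_ext (hU x hx).1) f.ext_emb
    refine ⟨g, (germ_eq_iff g f).2 fun s => GermRep.ext_ofSmoothOn _ _ _ _ _ s, ?_⟩
    rintro ⟨x, hx⟩
    refine (g.surjective_mfderiv_map_iff hx).2 ?_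
    have e : g.ext =ᶠ[𝓝 x] f.ext := by
      filter_upwards [U.isOpen.mem_nhds hx] with y hy
      exact GermRep.ext_apply g hy
    rw [SmoothMfd.deriv_congr e]
    exact (hU x hx).2

end GermCat

/-! ### Local slices of zero loci in vector spaces -/

section Slice

variable {B C K : Type*} [NormedAddCommGroup B] [NormedSpace ℝ B] [NormedAddCommGroup C]
  [NormedSpace ℝ C] [NormedAddCommGroup K] [NormedSpace ℝ K]

/-- Near `b₀`, the map `β` is a smooth parametrization of the zero locus of `g` with
derivative `ι`, and the linear map `P` restricts to its inverse. -/
structure IsSlice (g : B → C) (b₀ : B) (ι : K →L[ℝ] B) (P : B →L[ℝ] K) (β : K → B) : Prop where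
  map_base : β (P b₀) = b₀
  hasFDerivAt : HasFDerivAt β ι (P b₀)
  smooth : ∀ᶠ k in 𝓝 (P b₀), ContDiffAt ℝ ∞ β k
  zero : ∀ᶠ k in 𝓝 (P b₀), g (β k) = 0
  proj : ∀ᶠ k in 𝓝 (P b₀), P (β k) = k
  eq_of_zero : ∀ᶠ b in 𝓝 b₀, g b = 0 → β (P b) = b

variable [FiniteDimensional ℝ B] [FiniteDimensional ℝ C]

/-- The solution set of a maximal independent system of the equations `g = 0` is parametrized by
the kernel of the derivative. -/
theorem exists_slice_of_projection {g : B → C} {b₀ : B}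
    (hg : ∀ᶠ b in 𝓝 b₀, ContDiffAt ℝ ∞ g b) (h₀ : g b₀ = 0) (ι : K →L[ℝ] B)
    (hι : Function.Injective ι)
    (hr : LinearMap.range ι.toLinearMap = LinearMap.ker (fderiv ℝ g b₀).toLinearMap) :
    ∃ (Q : C →L[ℝ] LinearMap.range (fderiv ℝ g b₀).toLinearMap) (P : B →L[ℝ] K) (β : K → B),
      (∀ x : LinearMap.range (fderiv ℝ g b₀).toLinearMap, Q x = x) ∧
      (∀ k, P (ι k) = k) ∧ IsSlice (fun b => Q (g b)) b₀ ι P β := by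
  set g' := fderiv ℝ g b₀ with hg'
  set R := LinearMap.range g'.toLinearMap with hR
  obtain ⟨P₀, hP₀⟩ := ι.toLinearMap.exists_leftInverse_of_injective (LinearMap.ker_eq_bot.2 hι)
  let P : B →L[ℝ] K := LinearMap.toContinuousLinearMap P₀
  have hP : ∀ k, P (ι k) = k := fun k => LinearMap.congr_fun hP₀ k
  obtain ⟨Q₀, hQ₀⟩ := R.subtype.exists_leftInverse_of_injective R.ker_subtype
  let Q : C →L[ℝ] R := LinearMap.toContinuousLinearMap Q₀
  have hQ : ∀ x : R, Q x = x := fun x => LinearMap.congr_fun hQ₀ x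
  have hker : ∀ v, g' v = 0 ↔ ∃ k, ι k = v := fun v => by
    have := SetLike.ext_iff.1 hr v
    exact this.symm
  -- P is a left inverse of ι and Q a projection to the range R of g'. The kernel of Q ∘ g' is the
  -- image of ι, on which P is injective, so Φ is a local diffeomorphism at b₀.
  let Φ : B → K × R := fun b => (P b, Q (g b))
  let Φ' : B →L[ℝ] K × R := P.prod (Q.comp g')
  have hΦ'd : HasFDerivAt Φ Φ' b₀ := by
    have := (hg.self_of_nhds.differentiableAt (by simp)).hasFDerivAt
    exact P.hasFDerivAt.prodMk (Q.hasFDerivAt.comp b₀ this)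
  have hQg : ∀ v, Q (g' v) = ⟨g' v, v, rfl⟩ := fun v => hQ ⟨g' v, v, rfl⟩
  have hbij : Function.Bijective Φ' := by
    constructor
    · refine (injective_iff_map_eq_zero Φ').2 fun v hv => ?_
      have h1 : P v = 0 := congrArg Prod.fst hv
      have h2 : Q (g' v) = 0 := congrArg Prod.snd hv
      rw [hQg] at h2
      obtain ⟨k, rfl⟩ := (hker v).1 (congrArg Subtype.val h2)
      rw [hP] at h1
      rw [h1, map_zero]
    · rintro ⟨k, ⟨_, b, rfl⟩⟩
      -- Moving along the image of ι corrects the P-component and leaves g' unchanged.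
      refine ⟨b + ι (k - P b), Prod.ext ?_ ?_⟩
      · change P (b + ι (k - P b)) = k
        rw [map_add, hP]
        abel
      · change Q (g' (b + ι (k - P b))) = _
        rw [map_add, (hker _).2 ⟨_, rfl⟩, add_zero, hQg]
        rfl
  let Φe : B ≃L[ℝ] K × R := (LinearEquiv.ofBijective Φ'.toLinearMap hbij).toContinuousLinearEquiv
  have hΦe : (Φe : B →L[ℝ] K × R) = Φ' := rfl
  have hΦed : HasFDerivAt Φ (Φe : B →L[ℝ] K × R) b₀ := hΦ'd
  have hΦs : ∀ᶠ b in 𝓝 b₀, ContDiffAt ℝ ∞ Φ b := by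
    filter_upwards [hg] with b hb
    exact P.contDiff.contDiffAt.prodMk (Q.contDiff.contDiffAt.comp b hb)
  have : CompleteSpace B := FiniteDimensional.complete ℝ B
  let e := hΦs.self_of_nhds.toOpenPartialHomeomorph Φ hΦed (by simp)
  have he : ∀ b, e b = Φ b := fun b => rfl
  have hsrc : b₀ ∈ e.source := hΦs.self_of_nhds.mem_toOpenPartialHomeomorph_source hΦed (by simp)
  have hΦb : e b₀ = (P b₀, 0) := by
    rw [he]
    simp only [Φ, h₀, map_zero]
  -- The slice K × {0}, pulled back along Φ.
  let β : K → B := fun k => e.symm (k, 0)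
  have hβ₀ : β (P b₀) = b₀ := by
    simp only [β]
    rw [← hΦb, e.left_inv hsrc]
  have hc : Continuous fun k : K => (k, (0 : R)) := by fun_prop
  have hmem : (P b₀, (0 : R)) ∈ e.target := hΦb ▸ e.map_source hsrc
  have htgt : ∀ᶠ k in 𝓝 (P b₀), (k, (0 : R)) ∈ e.target :=
    hc.continuousAt.eventually (e.open_target.mem_nhds hmem)
  have hβc : ContinuousAt β (P b₀) :=
    ContinuousAt.comp (f := fun k : K => (k, (0 : R)))
      (e.continuousAt_symm hmem) hc.continuousAt
  have hinv : ∀ᶠ b in 𝓝 b₀, fderiv ℝ Φ b ∈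
      Set.range ((↑) : (B ≃L[ℝ] K × R) → B →L[ℝ] K × R) := by
    have h1 : ContinuousAt (fderiv ℝ Φ) b₀ :=
      (hΦs.self_of_nhds.fderiv_right (m := 0) (by norm_num)).continuousAt
    refine h1.eventually ?_
    rw [hΦ'd.fderiv, ← hΦe]
    exact Φe.nhds
  refine ⟨Q, P, β, hQ, hP, hβ₀, ?_, ?_, ?_, ?_, ?_⟩
  · have h1 : HasFDerivAt e.symm (Φe.symm : K × R →L[ℝ] B) (P b₀, 0) := by
      refine e.hasFDerivAt_symm hmem ?_
      have : e.symm (P b₀, 0) = b₀ := hβ₀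
      rw [this]
      exact hΦ'd
    have h2 := h1.comp (P b₀) (hasFDerivAt_prodMk_left (𝕜 := ℝ) (P b₀) (0 : R))
    have h3 : ι = (Φe.symm : K × R →L[ℝ] B).comp (ContinuousLinearMap.inl ℝ K R) := by
      ext k
      refine Φe.injective (Eq.trans ?_ (Φe.apply_symm_apply (k, 0)).symm)
      change (P (ι k), Q (g' (ι k))) = _
      rw [hP, (hker _).2 ⟨_, rfl⟩, map_zero]
    rw [h3]
    exact h2
  · have h1 : ∀ᶠ k in 𝓝 (P b₀), ContDiffAt ℝ ∞ Φ (β k) := by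
      refine hβc.tendsto.eventually (p := fun b => ContDiffAt ℝ ∞ Φ b) ?_
      rwa [hβ₀]
    have h2 : ∀ᶠ k in 𝓝 (P b₀), fderiv ℝ Φ (β k) ∈
        Set.range ((↑) : (B ≃L[ℝ] K × R) → B →L[ℝ] K × R) := by
      refine hβc.tendsto.eventually (p := fun b => fderiv ℝ Φ b ∈
        Set.range ((↑) : (B ≃L[ℝ] K × R) → B →L[ℝ] K × R)) ?_
      rwa [hβ₀]
    filter_upwards [h1, h2, htgt] with k hk1 hk2 hk3
    obtain ⟨E, hE⟩ := hk2
    have h3 : HasFDerivAt e (E : B →L[ℝ] K × R) (e.symm (k, 0)) := by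
      rw [hE]
      exact (hk1.differentiableAt (by simp)).hasFDerivAt
    exact (e.contDiffAt_symm hk3 h3 hk1).comp k (by fun_prop)
  · filter_upwards [htgt] with k hk
    exact congrArg Prod.snd (e.right_inv hk)
  · filter_upwards [htgt] with k hk
    exact congrArg Prod.fst (e.right_inv hk)
  · filter_upwards [e.open_source.mem_nhds hsrc] with b hb h
    have h1 : e b = (P b, 0) := by
      rw [he]
      exact Prod.ext rfl h
    simp only [β]
    rw [← h1, e.left_inv hb]

/-- The zero locus of `g` is parametrized by the kernel of its derivative if the derivative is
surjective, or if the kernel consists of the velocities of a family of solutions. -/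
theorem exists_slice [FiniteDimensional ℝ K] {g : B → C} {b₀ : B}
    (hg : ∀ᶠ b in 𝓝 b₀, ContDiffAt ℝ ∞ g b) (h₀ : g b₀ = 0) (ι : K →L[ℝ] B)
    (hι : Function.Injective ι)
    (hr : LinearMap.range ι.toLinearMap = LinearMap.ker (fderiv ℝ g b₀).toLinearMap)
    (h : Function.Surjective (fderiv ℝ g b₀) ∨
      ∃ (n : ℕ) (f : Euc n → B) (a₀ : Euc n), f a₀ = b₀ ∧ ContDiffAt ℝ ∞ f a₀ ∧
        (∀ᶠ a in 𝓝 a₀, g (f a) = 0) ∧ ∀ k, ∃ a, fderiv ℝ f a₀ a = ι k) :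
    ∃ (P : B →L[ℝ] K) (β : K → B), IsSlice g b₀ ι P β := by
  obtain ⟨Q, P, β, hQ, hP, hs⟩ := exists_slice_of_projection hg h₀ ι hι hr
  have heq : ∀ᶠ b in 𝓝 b₀, g b = 0 → β (P b) = b := by
    filter_upwards [hs.eq_of_zero] with b hb h
    exact hb (by simp [h])
  refine ⟨P, β, hs.map_base, hs.hasFDerivAt, hs.smooth, ?_, hs.proj, heq⟩
  rcases h with h | ⟨n, f, a₀, rfl, hf, hgf, ha⟩
  -- When the derivative is onto, its range is all of C and projecting by Q loses no equation.
  · filter_upwards [hs.zero] with k hk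
    obtain ⟨b, hb⟩ := h (g (β k))
    have h1 := hQ ⟨g (β k), b, hb⟩
    rw [hk] at h1
    exact (congrArg Subtype.val h1).symm
  · choose τ hτ using ha
    let bK := Module.finBasis ℝ K
    let σ : K →L[ℝ] Euc n := LinearMap.toContinuousLinearMap (bK.constr ℝ fun i => τ (bK i))
    have hσ : (fderiv ℝ f a₀).comp σ = ι := by
      refine ContinuousLinearMap.coe_injective (bK.ext fun i => ?_)
      change fderiv ℝ f a₀ (bK.constr ℝ (fun i => τ (bK i)) (bK i)) = ι (bK i)
      rw [bK.constr_basis, hτ]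
    -- σ lifts ι through the derivative of f, so η is a family of solutions with derivative ι. Since
    -- P ∘ η has derivative P ∘ ι = 1, every point near P b₀ is P (η k) for some k; there β takes
    -- the value η k, a solution of all the equations.
    let η : K → B := fun k => f (a₀ + σ (k - P (f a₀)))
    have haff : HasStrictFDerivAt (fun k : K => a₀ + σ (k - P (f a₀))) σ (P (f a₀)) :=
      (σ.hasStrictFDerivAt.comp _ ((hasStrictFDerivAt_id _).sub_const _)).const_add _
    have hη₀ : η (P (f a₀)) = f a₀ := by simp [η]
    have hη : HasStrictFDerivAt η ι (P (f a₀)) := by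
      rw [← hσ]
      refine HasStrictFDerivAt.comp (g := f) (P (f a₀)) ?_ haff
      simpa using hf.hasStrictFDerivAt (by simp)
    have hPη : HasStrictFDerivAt (P ∘ η)
        ((ContinuousLinearEquiv.refl ℝ K : K ≃L[ℝ] K) : K →L[ℝ] K) (P (f a₀)) := by
      have h' : ((ContinuousLinearEquiv.refl ℝ K : K ≃L[ℝ] K) : K →L[ℝ] K) = P.comp ι := by
        ext k
        exact (hP k).symm
      rw [h']
      exact P.hasStrictFDerivAt.comp _ hη
    have hcomp : CompleteSpace K := FiniteDimensional.complete ℝ K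
    have hmap := hPη.map_nhds_eq_of_equiv
    rw [Function.comp, hη₀] at hmap
    rw [← hmap, Filter.eventually_map]
    have h1 : ∀ᶠ k in 𝓝 (P (f a₀)), g (η k) = 0 := by
      have h2 : Filter.Tendsto (fun k : K => a₀ + σ (k - P (f a₀))) (𝓝 (P (f a₀))) (𝓝 a₀) := by
        have := haff.continuousAt
        rwa [ContinuousAt, sub_self, map_zero, add_zero] at this
      exact h2.eventually hgf
    have h3 : ∀ᶠ k in 𝓝 (P (f a₀)), g (η k) = 0 → β (P (η k)) = η k := by
      refine hη.continuousAt.tendsto.eventually (p := fun b => g b = 0 → β (P b) = b) ?_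
      rwa [hη₀]
    filter_upwards [h1, h3] with k hk1 hk3
    change g (β (P (η k))) = 0
    rw [hk3 hk1, hk1]

end Slice

/-! ### Manifolds from slice charts in a finite product of manifolds -/

section SliceMfd

variable {J : Type} (M : J → SmoothMfd.{u})

/-- The coordinates of a point of a product in the preferred charts at `b`. -/
noncomputable def prodCoord (b t : ∀ j, M j) (j : J) : Euc (M j).dim :=
  extChartAt (𝓡 (M j).dim) (b j) (t j)

/-- A slice chart of dimension `d` for a subset `H` of a product of manifolds: a smooth
parametrization `β` of `H ∩ V` by an open set `D`, whose inverse is linear in the coordinates. -/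
structure SliceChart (H : Set (∀ j, M j)) (d : ℕ) where
  base : ∀ j, M j
  P : (∀ j, Euc (M j).dim) →L[ℝ] Euc d
  β : Euc d → ∀ j, M j
  V : Set (∀ j, M j)
  D : Set (Euc d)
  isOpen_V : IsOpen V
  isOpen_D : IsOpen D
  mem_source : ∀ t ∈ V, ∀ j, t j ∈ (chartAt (Euc (M j).dim) (base j)).source
  coord_mem : ∀ t ∈ V, t ∈ H → P (prodCoord M base t) ∈ D
  β_mem_V : ∀ k ∈ D, β k ∈ V
  β_mem : ∀ k ∈ D, β k ∈ H
  left_inv : ∀ t ∈ V, t ∈ H → β (P (prodCoord M base t)) = t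
  right_inv : ∀ k ∈ D, P (prodCoord M base (β k)) = k
  smooth : ∀ k ∈ D, ∀ j, ContMDiffAt 𝓘(ℝ, Euc d) (𝓡 (M j).dim) ∞ (fun k => β k j) k

variable {M} {H : Set (∀ j, M j)} {d : ℕ}

namespace SliceChart

variable (c : SliceChart M H d)

/-- The coordinates of a slice chart. -/
noncomputable def coord (t : ∀ j, M j) : Euc d := c.P (prodCoord M c.base t)

theorem continuousOn_coord : ContinuousOn c.coord c.V := by
  refine c.P.continuous.comp_continuousOn (continuousOn_pi.2 fun j => ?_)
  refine (continuousOn_extChartAt (I := 𝓡 (M j).dim) (c.base j)).comp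
    (continuous_apply j).continuousOn fun t ht => ?_
  rw [extChartAt_source]
  exact c.mem_source t ht j

theorem continuousOn_β : ContinuousOn c.β c.D :=
  continuousOn_pi.2 fun j k hk => (c.smooth k hk j).continuousAt.continuousWithinAt

variable [Finite J]

theorem contMDiffAt_coord {E X Z : Type*} [NormedAddCommGroup E] [NormedSpace ℝ E]
    [TopologicalSpace X] {I : ModelWithCorners ℝ E X} [TopologicalSpace Z] [ChartedSpace X Z]
    {γ : Z → ∀ j, M j} {z : Z}
    (hγ : ∀ j, ContMDiffAt I (𝓡 (M j).dim) ∞ (fun z => γ z j) z) (hz : γ z ∈ c.V) :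
    ContMDiffAt I 𝓘(ℝ, Euc d) ∞ (fun z => c.coord (γ z)) z := by
  have := Fintype.ofFinite J
  have h1 : ContMDiffAt I 𝓘(ℝ, ∀ j, Euc (M j).dim) ∞ (fun z => prodCoord M c.base (γ z)) z := by
    rw [contMDiffAt_pi_space]
    intro j
    exact (contMDiffAt_extChartAt' (c.mem_source _ hz j)).comp z (hγ j)
  exact (c.P.contMDiff.contMDiffAt).comp z h1

end SliceChart

/-- The points of `H` that are covered by a family of slice charts. -/
abbrev SliceSpace {ι : Type*} (c : ι → SliceChart M H d) : Type u :=
  { t : ∀ j, M j // t ∈ H ∧ ∃ s, t ∈ (c s).V }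

namespace SliceSpace

variable {ι : Type*} (c : ι → SliceChart M H d)

theorem isInducing_val : IsInducing (Subtype.val : SliceSpace c → ∀ j, M j) := ⟨rfl⟩

theorem continuous_val : Continuous (Subtype.val : SliceSpace c → ∀ j, M j) :=
  continuous_subtype_val

instance [Finite J] : SecondCountableTopology (SliceSpace c) := (isInducing_val c).secondCountableTopology

open Classical in
/-- A slice chart as a chart. -/
noncomputable def chart (s : ι) (t₀ : SliceSpace c) :
    OpenPartialHomeomorph (SliceSpace c) (Euc d) where
  toFun t := (c s).coord t.1
  invFun k := if h : k ∈ (c s).D then ⟨(c s).β k, (c s).β_mem k h, s, (c s).β_mem_V k h⟩ else t₀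
  source := { t | t.1 ∈ (c s).V }
  target := (c s).D
  map_source' t ht := (c s).coord_mem t.1 ht t.2.1
  map_target' k hk := by
    simp only [dif_pos hk]
    exact (c s).β_mem_V k hk
  left_inv' t ht := by
    have h : (c s).coord t.1 ∈ (c s).D := (c s).coord_mem t.1 ht t.2.1
    simp only [dif_pos h]
    exact Subtype.ext ((c s).left_inv t.1 ht t.2.1)
  right_inv' k hk := by
    simp only [dif_pos hk]
    exact (c s).right_inv k hk
  open_source := (c s).isOpen_V.preimage (continuous_val c)
  open_target := (c s).isOpen_D
  continuousOn_toFun := (c s).continuousOn_coord.comp (continuous_val c).continuousOn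
    fun _ ht => ht
  continuousOn_invFun := by
    rw [(isInducing_val c).continuousOn_iff]
    refine (c s).continuousOn_β.congr fun k hk => ?_
    simp only [Function.comp, dif_pos hk]

theorem chart_symm_val (s : ι) (t₀ : SliceSpace c) {k : Euc d} (hk : k ∈ (c s).D) :
    ((chart c s t₀).symm k).1 = (c s).β k := by
  classical
  exact congrArg Subtype.val (dif_pos hk)

noncomputable instance : ChartedSpace (Euc d) (SliceSpace c) where
  atlas := { e | ∃ s t₀, e = chart c s t₀ }
  chartAt t := chart c t.2.2.choose t
  mem_chart_source t := t.2.2.choose_spec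
  chart_mem_atlas _ := ⟨_, _, rfl⟩

theorem contMDiff_proj (j : J) :
    ContMDiff (𝓡 d) (𝓡 (M j).dim) ∞ (fun t : SliceSpace c => t.1 j) := by
  intro t
  rw [contMDiffAt_iff_source]
  have ht : (chartAt (Euc d) t) t ∈ (chartAt (Euc d) t).target := mem_chart_target _ t
  refine ContMDiffAt.contMDiffWithinAt ?_
  refine ((c t.2.2.choose).smooth _ ht j).congr_of_eventuallyEq ?_
  filter_upwards [(c t.2.2.choose).isOpen_D.mem_nhds ht] with x hx
  exact congrFun (chart_symm_val c _ t hx) j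

variable [Finite J]

/-- A transition map is a parametrization followed by the coordinates of another slice chart, and
these are smooth on an open set of the ambient product. -/
instance : IsManifold (𝓡 d) ∞ (SliceSpace c) := by
  refine isManifold_of_contDiffOn _ _ _ ?_
  rintro _ _ ⟨s, t, rfl⟩ ⟨s', t', rfl⟩ k hk
  have hk' : k ∈ (c s).D ∧ (chart c s t).symm k ∈ (chart c s' t').source := by
    simpa using! hk
  have hV : (c s).β k ∈ (c s').V := by
    rw [← chart_symm_val c s t hk'.1]
    exact hk'.2
  have h1 : ContMDiffAt 𝓘(ℝ, Euc d) 𝓘(ℝ, Euc d) ∞ (fun k => (c s').coord ((c s).β k)) k :=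
    (c s').contMDiffAt_coord ((c s).smooth k hk'.1) hV
  refine ((contMDiffAt_iff_contDiffAt.1 h1).congr_of_eventuallyEq ?_).contDiffWithinAt
  filter_upwards [(c s).isOpen_D.mem_nhds hk'.1] with x hx
  exact congrArg (c s').coord (chart_symm_val c s t hx)

/-- The manifold of points that are covered by a family of slice charts. -/
noncomputable def mfd : SmoothMfd.{u} where
  dim := d
  carrier := SliceSpace c

/-- The projections of the manifold of points that are covered by slice charts. -/
noncomputable def proj (j : J) : mfd c ⟶ M j := ⟨fun t => t.1 j, contMDiff_proj c j⟩

/-- The embedded submanifold property: slice coordinates are restrictions of smooth functions on the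
product, so smoothness can be tested on the factors. -/
theorem contMDiffAt_lift {E X Z : Type*} [NormedAddCommGroup E] [NormedSpace ℝ E]
    [TopologicalSpace X] {I : ModelWithCorners ℝ E X} [TopologicalSpace Z] [ChartedSpace X Z]
    {γ : Z → SliceSpace c} {z : Z}
    (hγ : ∀ j, ContMDiffAt I (𝓡 (M j).dim) ∞ (fun z => (γ z).1 j) z) :
    ContMDiffAt I (𝓡 d) ∞ γ z := by
  rw [contMDiffAt_iff_target]
  refine ⟨?_, ?_⟩
  · rw [(isInducing_val c).continuousAt_iff]
    exact continuousAt_pi.2 fun j => (hγ j).continuousAt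
  · exact (c (γ z).2.2.choose).contMDiffAt_coord hγ (γ z).2.2.choose_spec

/-- At a point at which the parametrization `β` of a slice chart has an injective derivative `L`,
the image of `L` is the tangent space. -/
theorem exists_tangent_equiv (s : ι) (t : SliceSpace c) (ht : t.1 ∈ (c s).V)
    (L : ∀ j, Euc d →L[ℝ] Euc (M j).dim)
    (hL : ∀ j, mfderiv 𝓘(ℝ, Euc d) (𝓡 (M j).dim) (fun k => (c s).β k j) ((c s).coord t.1) = L j)
    (hinj : ∀ k, (∀ j, L j k = 0) → k = 0) :
    ∃ T : Euc d →L[ℝ] Euc d, Function.Bijective T ∧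
      ∀ j k, SmoothMfd.deriv (proj c j) t (T k) = L j k := by
  have hD : (c s).coord t.1 ∈ (c s).D := (c s).coord_mem t.1 ht t.2.1
  have hsm : ContMDiffAt 𝓘(ℝ, Euc d) (𝓡 d) ∞ (chart c s t).symm ((c s).coord t.1) := by
    refine contMDiffAt_lift c fun j => ((c s).smooth _ hD j).congr_of_eventuallyEq ?_
    filter_upwards [(c s).isOpen_D.mem_nhds hD] with x hx
    exact congrFun (chart_symm_val c _ t hx) j
  have hpt : (chart c s t).symm ((c s).coord t.1) = t := (chart c s t).left_inv ht
  let T : Euc d →L[ℝ] Euc d :=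
    mfderiv 𝓘(ℝ, Euc d) (𝓡 d) (chart c s t).symm ((c s).coord t.1)
  have key : ∀ j k, SmoothMfd.deriv (proj c j) t (T k) =
      L j k := by
    intro j k
    have h1 := mfderiv_comp_of_eq (I := 𝓘(ℝ, Euc d)) (I' := 𝓡 d) (I'' := 𝓡 (M j).dim)
      ((contMDiff_proj c j).mdifferentiable (by simp) t)
      (hsm.mdifferentiableAt (by simp)) hpt
    have h2 : (fun t : SliceSpace c => t.1 j) ∘ (chart c s t).symm =ᶠ[𝓝 ((c s).coord t.1)]
        fun k => (c s).β k j := by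
      filter_upwards [(c s).isOpen_D.mem_nhds hD] with x hx
      exact congrFun (chart_symm_val c _ t hx) j
    rw [hpt] at h1
    have h3 := h1.symm.trans (h2.mfderiv_eq.trans (hL j))
    exact DFunLike.congr_fun h3 k
  -- T is an endomorphism of a finite-dimensional space, so injectivity is enough.
  have hTinj : Function.Injective T := by
    refine (injective_iff_map_eq_zero T).2 fun k hk => hinj k fun j => ?_
    rw [← key j k, hk]
    exact map_zero _
  exact ⟨T, ⟨hTinj, LinearMap.surjective_of_injective (f := T.toLinearMap) hTinj⟩, key⟩

end SliceSpace

end SliceMfd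

/-! ### Maps between manifolds in charts -/

namespace SmoothMfd

variable {M N : SmoothMfd.{u}}

/-- A map between manifolds, written in the preferred charts at `x` and `y`. -/
noncomputable def inCharts (f : M → N) (x : M) (y : N) (z : Euc M.dim) : Euc N.dim :=
  extChartAt (𝓡 N.dim) y (f ((extChartAt (𝓡 M.dim) x).symm z))

theorem contDiffAt_inCharts {f : M → N} {x : M} {y : N} {z : Euc M.dim}
    (hz : z ∈ (extChartAt (𝓡 M.dim) x).target)
    (hf : ContMDiffAt (𝓡 M.dim) (𝓡 N.dim) ∞ f ((extChartAt (𝓡 M.dim) x).symm z))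
    (hy : f ((extChartAt (𝓡 M.dim) x).symm z) ∈ (chartAt (Euc N.dim) y).source) :
    ContDiffAt ℝ ∞ (inCharts f x y) z := by
  refine contMDiffAt_iff_contDiffAt.1 ?_
  have h1 : ContMDiffAt 𝓘(ℝ, Euc M.dim) (𝓡 M.dim) ∞ (extChartAt (𝓡 M.dim) x).symm z :=
    (contMDiffOn_extChartAt_symm x).contMDiffAt ((isOpen_extChartAt_target x).mem_nhds hz)
  exact (contMDiffAt_extChartAt' hy).comp z (hf.comp z h1)

theorem hasFDerivAt_inCharts {f : M → N} {x : M} {y : N}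
    (hf : MDifferentiableAt (𝓡 M.dim) (𝓡 N.dim) f x) (hy : f x = y) :
    HasFDerivAt (inCharts f x y) (deriv f x) (extChartAt (𝓡 M.dim) x x) := by
  subst hy
  have h := hf.hasMFDerivAt.2
  rw [ModelWithCorners.range_eq_univ] at h
  have h' : HasFDerivWithinAt (inCharts f x (f x)) (deriv f x) Set.univ
    (extChartAt (𝓡 M.dim) x x) := h
  exact hasFDerivWithinAt_univ.1 h'

end SmoothMfd

/-! ### Systems of equations between germs -/

/-- A family of germs of manifolds `M j`, with equations between germs defined on them. -/
structure GermSystem (S : SmoothMfd.{u}) (J L : Type) where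
  M : J → GermCat S
  C : L → GermCat S
  a : L → J
  b : L → J
  f : ∀ l, M (a l) ⟶ C l
  g : ∀ l, M (b l) ⟶ C l

namespace GermSystem

variable {S : SmoothMfd.{u}} {J L : Type} (E : GermSystem S J L)

/-- A family of germs that solves the equations. -/
def IsSolution {A : GermCat S} (φ : ∀ j, A ⟶ E.M j) : Prop :=
  ∀ l, φ (E.a l) ≫ E.f l = φ (E.b l) ≫ E.g l

variable [Nonempty S.carrier]

/-- The linearized equations at a point of `S`. -/
noncomputable def tangentEq (s : S) :
    (∀ j, Euc (E.M j).dim) →L[ℝ] ∀ l, Euc (E.C l).dim :=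
  ContinuousLinearMap.pi fun l =>
    (GermCat.tangent s (E.f l)).comp (ContinuousLinearMap.proj (E.a l)) -
      (GermCat.tangent s (E.g l)).comp (ContinuousLinearMap.proj (E.b l))

theorem tangentEq_apply (s : S) (v : ∀ j, Euc (E.M j).dim) (l : L) :
    E.tangentEq s v l = GermCat.tangent s (E.f l) (v (E.a l)) -
      GermCat.tangent s (E.g l) (v (E.b l)) := rfl

theorem tangentEq_eq_zero_iff (s : S) (v : ∀ j, Euc (E.M j).dim) :
    E.tangentEq s v = 0 ↔ ∀ l, GermCat.tangent s (E.f l) (v (E.a l)) =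
      GermCat.tangent s (E.g l) (v (E.b l)) := by
  simp only [funext_iff, tangentEq_apply, Pi.zero_apply, sub_eq_zero]

theorem IsSolution.tangentEq_eq_zero {E : GermSystem S J L} {A : GermCat S}
    {φ : ∀ j, A ⟶ E.M j} (h : E.IsSolution φ) (s : S) (w : Euc A.dim) :
    E.tangentEq s (fun j => GermCat.tangent s (φ j) w) = 0 := by
  refine (E.tangentEq_eq_zero_iff s _).2 fun l => ?_
  have := congrArg (fun χ => GermCat.tangent s χ w) (h l)
  simpa only [GermCat.tangent_comp, ContinuousLinearMap.comp_apply] using this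

/-- The equations are regular at a point of `S`: either the linearized equations are independent,
or the solutions of the linearized equations are the velocities of a family of solutions. -/
def IsRegularAt (s : S) : Prop :=
  Function.Surjective (E.tangentEq s) ∨ ∃ (A : GermCat S) (φ : ∀ j, A ⟶ E.M j), E.IsSolution φ ∧
    ∀ v, E.tangentEq s v = 0 → ∃ w, ∀ j, GermCat.tangent s (φ j) w = v j

/-- Representatives of the germs of a system of equations. -/
structure Rep where
  F : ∀ l, GermRep (E.M (E.a l)).toEmb (E.C l).toEmb
  G : ∀ l, GermRep (E.M (E.b l)).toEmb (E.C l).toEmb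
  germ_F : ∀ l, (F l).germ = E.f l
  germ_G : ∀ l, (G l).germ = E.g l

omit [Nonempty S.carrier] in
theorem nonempty_rep : Nonempty E.Rep := by
  choose F hF using fun l => GermCat.exists_rep (E.f l)
  choose G hG using fun l => GermCat.exists_rep (E.g l)
  exact ⟨⟨F, G, hF, hG⟩⟩

/-- The family of manifolds underlying a family of germs of manifolds. -/
abbrev X (j : J) : SmoothMfd.{u} := (E.M j).toEmb.mfd

/-- The family of points given by a point of `S`. -/
def base (s : S) (j : J) : E.X j := (E.M j).toEmb.emb s

namespace Rep

variable {E} (R : E.Rep)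

/-- The solutions of the equations between the representatives. -/
def sol : Set (∀ j, E.X j) :=
  { t | ∀ l, t (E.a l) ∈ (R.F l).dom ∧ t (E.b l) ∈ (R.G l).dom ∧
    (R.F l).ext (t (E.a l)) = (R.G l).ext (t (E.b l)) }

theorem base_mem_sol (s : S) : E.base s ∈ R.sol := fun l =>
  ⟨(R.F l).mem_dom s, (R.G l).mem_dom s, by
    rw [base, base, GermRep.ext_emb, GermRep.ext_emb]⟩

/-- The left hand sides of the equations in charts. -/
noncomputable def lhs (s : S) (l : L) : Euc (E.X (E.a l)).dim → Euc (E.C l).dim :=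
  SmoothMfd.inCharts (R.F l).ext (E.base s (E.a l)) ((E.C l).toEmb.emb s)

/-- The right hand sides of the equations in charts. -/
noncomputable def rhs (s : S) (l : L) : Euc (E.X (E.b l)).dim → Euc (E.C l).dim :=
  SmoothMfd.inCharts (R.G l).ext (E.base s (E.b l)) ((E.C l).toEmb.emb s)

/-- The equations in charts. -/
noncomputable def eqn (s : S) (v : ∀ j, Euc (E.M j).dim) (l : L) : Euc (E.C l).dim :=
  R.lhs s l (v (E.a l)) - R.rhs s l (v (E.b l))

/-- The coordinates at which the equations in charts are defined. -/
def good (s : S) (v : ∀ j, Euc (E.M j).dim) : Prop :=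
  (∀ j, v j ∈ (extChartAt (𝓡 (E.X j).dim) (E.base s j)).target) ∧
  ∀ l, (extChartAt (𝓡 (E.X (E.a l)).dim) (E.base s (E.a l))).symm (v (E.a l)) ∈ (R.F l).dom ∧
    (extChartAt (𝓡 (E.X (E.b l)).dim) (E.base s (E.b l))).symm (v (E.b l)) ∈ (R.G l).dom ∧
    (R.F l).ext ((extChartAt (𝓡 (E.X (E.a l)).dim) (E.base s (E.a l))).symm (v (E.a l))) ∈
      (chartAt (Euc (E.C l).dim) ((E.C l).toEmb.emb s)).source ∧
    (R.G l).ext ((extChartAt (𝓡 (E.X (E.b l)).dim) (E.base s (E.b l))).symm (v (E.b l))) ∈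
      (chartAt (Euc (E.C l).dim) ((E.C l).toEmb.emb s)).source

theorem eventually_dom {A B : GermCat S} (f : GermRep A.toEmb B.toEmb) (s : S) :
    ∀ᶠ z in 𝓝 (extChartAt (𝓡 A.dim) (A.toEmb.emb s) (A.toEmb.emb s)),
      (extChartAt (𝓡 A.dim) (A.toEmb.emb s)).symm z ∈ f.dom ∧
      f.ext ((extChartAt (𝓡 A.dim) (A.toEmb.emb s)).symm z) ∈
        (chartAt (Euc B.dim) (B.toEmb.emb s)).source := by
  have h1 : Filter.Tendsto (extChartAt (𝓡 A.dim) (A.toEmb.emb s)).symm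
      (𝓝 (extChartAt (𝓡 A.dim) (A.toEmb.emb s) (A.toEmb.emb s))) (𝓝 (A.toEmb.emb s)) := by
    have := continuousAt_extChartAt_symm (I := 𝓡 A.dim) (A.toEmb.emb s)
    rwa [ContinuousAt, extChartAt_to_inv] at this
  have h2 : ∀ᶠ x in 𝓝 (A.toEmb.emb s), f.ext x ∈ (chartAt (Euc B.dim) (B.toEmb.emb s)).source := by
    have h3 := (f.contMDiffAt_ext (f.mem_dom s)).continuousAt.tendsto
    rw [f.ext_emb] at h3
    exact h3 ((chartAt (Euc B.dim) (B.toEmb.emb s)).open_source.mem_nhds (mem_chart_source _ _))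
  exact h1 ((f.dom_mem_nhds (f.mem_dom s)).and h2)

theorem eventually_good [Finite J] [Finite L] (s : S) :
    ∀ᶠ v in 𝓝 (prodCoord E.X (E.base s) (E.base s)), R.good s v := by
  have hc : ∀ j, Filter.Tendsto (fun v : ∀ j, Euc (E.M j).dim => v j)
      (𝓝 (prodCoord E.X (E.base s) (E.base s)))
      (𝓝 (extChartAt (𝓡 (E.X j).dim) (E.base s j) (E.base s j))) :=
    fun j => (continuous_apply j).tendsto _
  refine (Filter.eventually_all.2 fun j => (hc j) (extChartAt_target_mem_nhds _)).and
    (Filter.eventually_all.2 fun l => ?_)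
  filter_upwards [(hc (E.a l)) (eventually_dom (R.F l) s),
    (hc (E.b l)) (eventually_dom (R.G l) s)] with v h1 h2
  exact ⟨h1.1, h2.1, h1.2, h2.2⟩

theorem contDiffAt_eqn [Fintype J] [Fintype L] {s : S} {v : ∀ j, Euc (E.M j).dim}
    (h : R.good s v) : ContDiffAt ℝ ∞ (R.eqn s) v := by
  refine contDiffAt_pi.2 fun l => ?_
  obtain ⟨h1, h2, h3, h4⟩ := h.2 l
  have k1 : ContDiffAt ℝ ∞ (R.lhs s l) (v (E.a l)) :=
    SmoothMfd.contDiffAt_inCharts (h.1 _) ((R.F l).contMDiffAt_ext h1) h3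
  have k2 : ContDiffAt ℝ ∞ (R.rhs s l) (v (E.b l)) :=
    SmoothMfd.contDiffAt_inCharts (h.1 _) ((R.G l).contMDiffAt_ext h2) h4
  exact (k1.comp v (ContinuousLinearMap.proj (R := ℝ)
    (φ := fun j => Euc (E.M j).dim) (E.a l)).contDiff.contDiffAt).sub
    (k2.comp v (ContinuousLinearMap.proj (R := ℝ)
      (φ := fun j => Euc (E.M j).dim) (E.b l)).contDiff.contDiffAt)

/-- The charts are the preferred ones at the base point, where the derivative in charts is the
tangent map itself. -/
theorem hasFDerivAt_eqn [Fintype J] [Fintype L] (s : S) :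
    HasFDerivAt (R.eqn s) (E.tangentEq s) (prodCoord E.X (E.base s) (E.base s)) := by
  refine hasFDerivAt_pi.2 fun l => ?_
  set v := prodCoord E.X (E.base s) (E.base s)
  have k1 : HasFDerivAt (R.lhs s l) (GermCat.tangent s (E.f l)) (v (E.a l)) := by
    rw [← R.germ_F, GermCat.tangent_germ]
    exact SmoothMfd.hasFDerivAt_inCharts
      ((R.F l).mdifferentiableAt_ext ((R.F l).mem_dom s)) ((R.F l).ext_emb s)
  have k2 : HasFDerivAt (R.rhs s l) (GermCat.tangent s (E.g l)) (v (E.b l)) := by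
    rw [← R.germ_G, GermCat.tangent_germ]
    exact SmoothMfd.hasFDerivAt_inCharts
      ((R.G l).mdifferentiableAt_ext ((R.G l).mem_dom s)) ((R.G l).ext_emb s)
  have p1 := (ContinuousLinearMap.proj (R := ℝ) (φ := fun j => Euc (E.M j).dim)
    (E.a l)).hasFDerivAt (x := v)
  have p2 := (ContinuousLinearMap.proj (R := ℝ) (φ := fun j => Euc (E.M j).dim)
    (E.b l)).hasFDerivAt (x := v)
  exact (k1.comp v p1).sub (k2.comp v p2)

theorem eqn_prodCoord {s : S} {t : ∀ j, E.X j}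
    (ht : ∀ j, t j ∈ (chartAt (Euc (E.X j).dim) (E.base s j)).source) (h : t ∈ R.sol) :
    R.eqn s (prodCoord E.X (E.base s) t) = 0 := by
  funext l
  simp only [eqn, lhs, rhs, SmoothMfd.inCharts, prodCoord, Pi.zero_apply, sub_eq_zero]
  rw [(extChartAt _ _).left_inv (by simpa using ht (E.a l)),
    (extChartAt _ _).left_inv (by simpa using ht (E.b l)), (h l).2.2]

theorem mem_sol_of_eqn {s : S} {v : ∀ j, Euc (E.M j).dim} (h : R.good s v)
    (h0 : R.eqn s v = 0) :
    (fun j => (extChartAt (𝓡 (E.X j).dim) (E.base s j)).symm (v j)) ∈ R.sol := by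
  intro l
  obtain ⟨h1, h2, h3, h4⟩ := h.2 l
  refine ⟨h1, h2, ?_⟩
  have h5 := sub_eq_zero.1 (congrFun h0 l)
  exact (extChartAt (𝓡 (E.C l).dim) ((E.C l).toEmb.emb s)).injOn (by simpa using h3)
    (by simpa using h4) h5

end Rep

end GermSystem

/-! ### Slice charts for the solutions of regular systems -/

namespace GermSystem

variable {S : SmoothMfd.{u}} {J L : Type} {E : GermSystem S J L} [Nonempty S.carrier]

namespace Rep

variable (R : E.Rep)

theorem eventually_mem_sol [Finite L] {A : GermCat S}
    (Φ : ∀ j, GermRep A.toEmb (E.M j).toEmb) (h : E.IsSolution fun j => (Φ j).germ) (s : S) :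
    ∀ᶠ x in 𝓝 (A.toEmb.emb s), (fun j => (Φ j).ext x) ∈ R.sol := by
  refine Filter.eventually_all.2 fun l => ?_
  have hdom : ∀ {B C : GermCat S} (f : GermRep A.toEmb B.toEmb) (g : GermRep B.toEmb C.toEmb),
      ∀ᶠ x in 𝓝 (A.toEmb.emb s), f.ext x ∈ g.dom := fun f g => by
    have h1 := (f.contMDiffAt_ext (f.mem_dom s)).continuousAt.tendsto
    rw [f.ext_emb] at h1
    exact h1 (g.dom_mem_nhds (g.mem_dom s))
  have h2 := h l
  rw [← R.germ_F, ← R.germ_G, GermCat.germ_comp, GermCat.germ_comp, GermCat.germ_eq_iff] at h2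
  have h3 := ((Φ (E.a l)).ext_comp (R.F l) s).symm.trans
    ((h2 s).trans ((Φ (E.b l)).ext_comp (R.G l) s))
  filter_upwards [hdom (Φ (E.a l)) (R.F l), hdom (Φ (E.b l)) (R.G l), h3] with x h4 h5 h6
  exact ⟨h4, h5, h6⟩

/-- Regular equations between germs have a parametrized solution set, in charts. -/
theorem exists_isSlice [Fintype J] [Fintype L] (s : S) {d : ℕ}
    (hd : Module.finrank ℝ (LinearMap.ker (E.tangentEq s).toLinearMap) = d)
    (hreg : E.IsRegularAt s) :
    ∃ (ι : Euc d →L[ℝ] ∀ j, Euc (E.M j).dim) (P : (∀ j, Euc (E.M j).dim) →L[ℝ] Euc d)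
      (β : Euc d → ∀ j, Euc (E.M j).dim), Function.Injective ι ∧
      (∀ v, E.tangentEq s v = 0 ↔ ∃ k, ι k = v) ∧
      IsSlice (R.eqn s) (prodCoord E.X (E.base s) (E.base s)) ι P β := by
  set v₀ := prodCoord E.X (E.base s) (E.base s) with hv₀
  have hfd : fderiv ℝ (R.eqn s) v₀ = E.tangentEq s := (R.hasFDerivAt_eqn s).fderiv
  obtain ⟨e⟩ := FiniteDimensional.nonempty_linearEquiv_of_finrank_eq (R := ℝ)
    (M := Euc d) (M' := LinearMap.ker (E.tangentEq s).toLinearMap) (by rw [hd]; simp)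
  let ι : Euc d →L[ℝ] ∀ j, Euc (E.M j).dim := LinearMap.toContinuousLinearMap
    ((LinearMap.ker (E.tangentEq s).toLinearMap).subtype.comp e.toLinearMap)
  have hι : Function.Injective ι := Subtype.val_injective.comp e.injective
  have hιr : ∀ v, E.tangentEq s v = 0 ↔ ∃ k, ι k = v := fun v =>
    ⟨fun h => ⟨e.symm ⟨v, h⟩, congrArg Subtype.val (e.apply_symm_apply ⟨v, h⟩)⟩, by
      rintro ⟨k, rfl⟩
      exact (e k).2⟩
  have hreg' : Function.Surjective (fderiv ℝ (R.eqn s) v₀) ∨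
      ∃ (n : ℕ) (f : Euc n → ∀ j, Euc (E.M j).dim) (a₀ : Euc n), f a₀ = v₀ ∧ ContDiffAt ℝ ∞ f a₀ ∧
        (∀ᶠ a in 𝓝 a₀, R.eqn s (f a) = 0) ∧ ∀ k, ∃ a, fderiv ℝ f a₀ a = ι k := by
    rw [hfd]
    refine hreg.imp_right ?_
    rintro ⟨A, φ, hφ, hv⟩
    -- Representatives of the germs that solve the system, read in charts, give the family of
    -- solutions required by `exists_slice`.
    choose Φ hΦ using fun j => GermCat.exists_rep (φ j)
    set x₀ := A.toEmb.emb s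
    have hsymm : (extChartAt (𝓡 A.dim) x₀).symm (extChartAt (𝓡 A.dim) x₀ x₀) = x₀ :=
      extChartAt_to_inv x₀
    refine ⟨A.dim, fun a j => SmoothMfd.inCharts (Φ j).ext x₀ (E.base s j) a,
      extChartAt (𝓡 A.dim) x₀ x₀, ?_, ?_, ?_, ?_⟩
    · funext j
      simp only [SmoothMfd.inCharts]
      rw [hsymm, GermRep.ext_emb]
      rfl
    · refine contDiffAt_pi.2 fun j => SmoothMfd.contDiffAt_inCharts (mem_extChartAt_target x₀) ?_ ?_
      · rw [hsymm]
        exact (Φ j).contMDiffAt_ext ((Φ j).mem_dom s)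
      · rw [hsymm, GermRep.ext_emb]
        exact mem_chart_source _ _
    · have h1 : ∀ᶠ x in 𝓝 x₀, (fun j => (Φ j).ext x) ∈ R.sol :=
        R.eventually_mem_sol Φ (by simpa only [hΦ] using hφ) s
      have h2 : ∀ᶠ x in 𝓝 x₀, ∀ j, (Φ j).ext x ∈
          (chartAt (Euc (E.X j).dim) (E.base s j)).source := by
        refine Filter.eventually_all.2 fun j => ?_
        have h3 := ((Φ j).contMDiffAt_ext ((Φ j).mem_dom s)).continuousAt.tendsto
        rw [(Φ j).ext_emb] at h3
        exact h3 ((chartAt _ _).open_source.mem_nhds (mem_chart_source _ _))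
      have h4 := (continuousAt_extChartAt_symm (I := 𝓡 A.dim) x₀).tendsto
      rw [hsymm] at h4
      filter_upwards [h4 (h1.and h2)] with a ha
      exact R.eqn_prodCoord ha.2 ha.1
    · intro k
      obtain ⟨w, hw⟩ := hv (ι k) ((hιr _).2 ⟨k, rfl⟩)
      refine ⟨w, ?_⟩
      have h1 := hasFDerivAt_pi.2 fun j => SmoothMfd.hasFDerivAt_inCharts (y := E.base s j)
        ((Φ j).mdifferentiableAt_ext ((Φ j).mem_dom s)) ((Φ j).ext_emb s)
      rw [h1.fderiv]
      funext j
      rw [← hw j, ← hΦ j]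
      rfl
  obtain ⟨P, β, h⟩ := exists_slice (g := R.eqn s) (b₀ := v₀)
    ((R.eventually_good s).mono fun v hv => R.contDiffAt_eqn hv)
    (R.eqn_prodCoord (fun j => mem_chart_source _ _) (R.base_mem_sol s)) ι hι
    (by
      rw [hfd]
      ext v
      exact (hιr v).symm) hreg'
  exact ⟨ι, P, β, hι, hιr, h⟩

/-- Regular equations between germs have a slice chart. -/
theorem exists_sliceChart [Fintype J] [Fintype L] (s : S) {d : ℕ}
    (hd : Module.finrank ℝ (LinearMap.ker (E.tangentEq s).toLinearMap) = d)
    (hreg : E.IsRegularAt s) :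
    ∃ (c : SliceChart E.X R.sol d) (ι : Euc d →L[ℝ] ∀ j, Euc (E.M j).dim),
      E.base s ∈ c.V ∧ Function.Injective ι ∧ (∀ v, E.tangentEq s v = 0 ↔ ∃ k, ι k = v) ∧
      ∀ j, mfderiv 𝓘(ℝ, Euc d) (𝓡 (E.X j).dim) (fun k => c.β k j) (c.coord (E.base s)) =
        (ContinuousLinearMap.proj j).comp ι := by
  obtain ⟨ι, P, β, hι, hιr, hs⟩ := R.exists_isSlice s hd hreg
  set v₀ := prodCoord E.X (E.base s) (E.base s) with hv₀
  obtain ⟨N, hN, hN'⟩ := exists_opens_interior fun v => R.good s v ∧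
    (R.eqn s v = 0 → β (P v) = v)
  obtain ⟨D₀, hD₀, hD₀'⟩ := exists_opens_interior fun k => ContDiffAt ℝ ∞ β k ∧
    R.eqn s (β k) = 0 ∧ P (β k) = k
  have hvN : v₀ ∈ N := hN' _ ((R.eventually_good s).and hs.eq_of_zero)
  have hvD : P v₀ ∈ D₀ := hD₀' _ (hs.smooth.and (hs.zero.and hs.proj))
  have hβc : ContinuousOn β D₀ := fun k hk =>
    ((hD₀ k hk).1.continuousAt).continuousWithinAt
  -- D₀ is cut down so that β lands in N, where the equations make sense in charts and β inverts P
  -- on solutions. V below is cut down accordingly, so that P maps its coordinates into D.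
  let D : Set (Euc d) := D₀ ∩ β ⁻¹' N
  have hDo : IsOpen D := hβc.isOpen_inter_preimage D₀.isOpen N.isOpen
  let V₀ : Set (∀ j, E.X j) := Set.univ.pi fun j => (chartAt (Euc (E.X j).dim) (E.base s j)).source
  have hV₀ : IsOpen V₀ := isOpen_set_pi Set.finite_univ fun j _ => (chartAt _ _).open_source
  have hcoord : ContinuousOn (prodCoord E.X (E.base s)) V₀ :=
    continuousOn_pi.2 fun j => (continuousOn_extChartAt (I := 𝓡 (E.X j).dim) (E.base s j)).comp
      (continuous_apply j).continuousOn fun t ht => by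
        rw [extChartAt_source]
        exact ht j trivial
  let V : Set (∀ j, E.X j) := V₀ ∩ prodCoord E.X (E.base s) ⁻¹' (N ∩ P ⁻¹' D)
  have hVo : IsOpen V :=
    hcoord.isOpen_inter_preimage hV₀ (N.isOpen.inter (hDo.preimage P.continuous))
  let ρ : Euc d → ∀ j, E.X j := fun k j =>
    (extChartAt (𝓡 (E.X j).dim) (E.base s j)).symm (β k j)
  have hρ : ∀ k ∈ D, prodCoord E.X (E.base s) (ρ k) = β k := fun k hk => funext fun j =>
    (extChartAt (𝓡 (E.X j).dim) (E.base s j)).right_inv ((hN _ hk.2).1.1 j)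
  let c : SliceChart E.X R.sol d :=
    { base := E.base s
      P := P
      β := ρ
      V := V
      D := D
      isOpen_V := hVo
      isOpen_D := hDo
      mem_source := fun t ht j => ht.1 j trivial
      coord_mem := fun t ht _ => ht.2.2
      β_mem_V := fun k hk => by
        refine ⟨fun j _ => ?_, ?_⟩
        · have := (extChartAt (𝓡 (E.X j).dim) (E.base s j)).map_target ((hN _ hk.2).1.1 j)
          rwa [extChartAt_source] at this
        · rw [Set.mem_preimage, hρ k hk]
          refine ⟨hk.2, ?_⟩
          rw [Set.mem_preimage, (hD₀ k hk.1).2.2]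
          exact hk
      β_mem := fun k hk => R.mem_sol_of_eqn (hN _ hk.2).1 (hD₀ k hk.1).2.1
      left_inv := fun t ht h => by
        have h1 := (hN _ ht.2.1).2 (R.eqn_prodCoord (fun j => ht.1 j trivial) h)
        funext j
        simp only [ρ]
        rw [h1]
        exact (extChartAt _ _).left_inv (by simpa using ht.1 j trivial)
      right_inv := fun k hk => by
        rw [hρ k hk, (hD₀ k hk.1).2.2]
      smooth := fun k hk j => by
        have h1 : ContDiffAt ℝ ∞ (fun k => β k j) k := contDiffAt_pi.1 (hD₀ k hk.1).1 j
        have h2 := (contMDiffOn_extChartAt_symm (I := 𝓡 (E.X j).dim) (n := ∞)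
          (E.base s j)).contMDiffAt ((isOpen_extChartAt_target _).mem_nhds ((hN _ hk.2).1.1 j))
        exact h2.comp k h1.contMDiffAt }
  refine ⟨c, ι, ⟨fun j _ => mem_chart_source _ _, hvN, hvD, ?_⟩, hι, hιr, fun j => ?_⟩
  · rw [Set.mem_preimage, hs.map_base]
    exact hvN
  · have h1 : HasFDerivAt (fun k => β k j) ((ContinuousLinearMap.proj j).comp ι) (P v₀) :=
      (ContinuousLinearMap.proj (R := ℝ) (φ := fun j => Euc (E.M j).dim) j).hasFDerivAt.comp
        (P v₀) hs.hasFDerivAt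
    have h2 := (contMDiffOn_extChartAt_symm (I := 𝓡 (E.X j).dim) (n := ∞)
      (E.base s j)).contMDiffAt (extChartAt_target_mem_nhds (E.base s j))
    -- Tangent vectors at the base point are expressed in this very chart, so its inverse has
    -- derivative the identity.
    have h3 := mfderivWithin_range_extChartAt_symm (I := 𝓡 (E.X j).dim) (x := E.base s j)
    rw [ModelWithCorners.range_eq_univ, mfderivWithin_univ] at h3
    have h4 := mfderiv_comp_of_eq (I := 𝓘(ℝ, Euc d)) (I' := 𝓘(ℝ, Euc (E.X j).dim))
      (I'' := 𝓡 (E.X j).dim) (x := P v₀) (f := fun k => β k j)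
      (h2.mdifferentiableAt (by simp)) h1.differentiableAt.mdifferentiableAt
      (congrFun hs.map_base j)
    have h5 : mfderiv 𝓘(ℝ, Euc d) 𝓘(ℝ, Euc (E.X j).dim) (fun k => β k j) (P v₀) =
      (ContinuousLinearMap.proj j).comp ι := mfderiv_eq_fderiv.trans h1.fderiv
    have h6 : mfderiv 𝓘(ℝ, Euc (E.X j).dim) (𝓡 (E.X j).dim)
        (extChartAt (𝓡 (E.X j).dim) (E.base s j)).symm (β (P v₀) j) =
        ContinuousLinearMap.id ℝ _ := by
      rw [hs.map_base]
      exact h3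
    rw [h5, h6] at h4
    exact h4.trans (ContinuousLinearMap.id_comp _)

end Rep
end GermSystem

/-! ### Universal solutions of regular systems -/

namespace GermSystem

variable {S : SmoothMfd.{u}} {J L : Type} {E : GermSystem S J L} [Nonempty S.carrier]

/-- A universal solution of a system of equations between germs, whose tangent spaces are the
solution spaces of the linearized equations. -/
structure UniversalSolution (E : GermSystem S J L) where
  T : GermCat S
  π : ∀ j, T ⟶ E.M j
  isSolution : E.IsSolution π
  exists_lift : ∀ {Z : GermCat S} (z : ∀ j, Z ⟶ E.M j), E.IsSolution z →
    ∃ h : Z ⟶ T, ∀ j, h ≫ π j = z j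
  hom_ext : ∀ {Z : GermCat S} (h h' : Z ⟶ T), (∀ j, h ≫ π j = h' ≫ π j) → h = h'
  tangent_injective : ∀ s u, (∀ j, GermCat.tangent s (π j) u = 0) → u = 0
  exists_tangent : ∀ s v, E.tangentEq s v = 0 → ∃ u, ∀ j, GermCat.tangent s (π j) u = v j

/-- The tangent spaces of `U.T` embed in the spaces of linearized solutions, so it suffices that the
velocities of h reach all of these. -/
theorem UniversalSolution.submersionGerms {E : GermSystem S J L} (U : E.UniversalSolution)
    {A : GermCat S} (h : A ⟶ U.T)
    (hh : ∀ s v, E.tangentEq s v = 0 → ∃ w, ∀ j, GermCat.tangent s (h ≫ U.π j) w = v j) :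
    submersionGerms S h := by
  refine (GermCat.submersionGerms_iff h).2 fun s u => ?_
  obtain ⟨w, hw⟩ := hh s _ (U.isSolution.tangentEq_eq_zero s u)
  refine ⟨w, sub_eq_zero.1 (U.tangent_injective s _ fun j => ?_)⟩
  rw [map_sub, sub_eq_zero, ← hw j, GermCat.tangent_comp]
  rfl

/-- Regular equations between germs, whose linearizations have solution spaces of constant
dimension, have a universal solution. -/
theorem nonempty_universalSolution [Finite J] [Nonempty J] [Finite L] (d : ℕ)
    (hd : ∀ s, Module.finrank ℝ (LinearMap.ker (E.tangentEq s).toLinearMap) = d)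
    (hreg : ∀ s, E.IsRegularAt s) : Nonempty E.UniversalSolution := by
  classical
  have := Fintype.ofFinite J
  have := Fintype.ofFinite L
  obtain ⟨R⟩ := E.nonempty_rep
  -- Constant kernel dimension enters here: slice charts around all points of S share the model `Euc
  -- d` and form one manifold.
  choose c ι hV hι hιr hder using fun s => R.exists_sliceChart s (hd s) (hreg s)
  let e₀ : S → SliceSpace c := fun s => ⟨E.base s, R.base_mem_sol s, s, hV s⟩
  have he₀ : ContMDiff (𝓡 S.dim) (𝓡 d) ∞ e₀ := fun s =>
    SliceSpace.contMDiffAt_lift c fun j => SmoothMfd.smooth (E.M j).toEmb.emb s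
  let e : S ⟶ SliceSpace.mfd c := ⟨e₀, he₀⟩
  have hproj : ∀ j, e ≫ SliceSpace.proj c j = (E.M j).toEmb.emb := fun j => rfl
  -- One projection suffices to see that e is an embedding: followed by it, e is the given embedding
  -- of S in the manifold of index `j₀`.
  have j₀ : J := Classical.arbitrary J
  have hemb : SmoothMfd.IsEmb e := by
    have h0 := (E.M j₀).toEmb.isEmb
    refine ⟨IsEmbedding.of_comp (SmoothMfd.smooth e).continuous
      (SmoothMfd.smooth (SliceSpace.proj c j₀)).continuous h0.isEmbedding, fun s => ?_⟩
    have h1 := mfderiv_comp s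
      ((SmoothMfd.smooth (SliceSpace.proj c j₀)).mdifferentiable (by simp) (e s))
      ((SmoothMfd.smooth e).mdifferentiable (by simp) s)
    have h2 := h0.injective_mfderiv s
    have h3 : (SliceSpace.proj c j₀ : SliceSpace.mfd c → E.X j₀) ∘ e = (E.M j₀).toEmb.emb := rfl
    rw [h3] at h1
    rw [h1] at h2
    exact Function.Injective.of_comp h2
  let T : GermCat S := ⟨⟨SliceSpace.mfd c, e, hemb⟩⟩
  let p : ∀ j, T.toEmb ⟶ (E.M j).toEmb := fun j => ⟨SliceSpace.proj c j, hproj j⟩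
  let π : ∀ j, T ⟶ E.M j := fun j => (GermRep.ofHom (p j)).germ
  have hπe : ∀ j, (GermRep.ofHom (p j)).ext = SliceSpace.proj c j := fun j =>
    GermRep.ext_ofHom (p j)
  have htan : ∀ s, ∃ F : Euc d →L[ℝ] Euc d, Function.Bijective F ∧
      ∀ j k, GermCat.tangent s (π j) (F k) = ι s k j := fun s => by
    obtain ⟨F, hF, hF'⟩ := SliceSpace.exists_tangent_equiv c s (e₀ s) (hV s)
      (fun j => (ContinuousLinearMap.proj j).comp (ι s)) (hder s)
      (fun k hk => hι s ((funext hk : ι s k = 0).trans (map_zero _).symm))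
    refine ⟨F, hF, fun j k => ?_⟩
    rw [← show _ = ι s k j from hF' j k, GermCat.tangent_germ, hπe j]
    rfl
  refine ⟨⟨T, π, ?_, ?_, ?_, ?_, ?_⟩⟩
  · intro l
    rw [← R.germ_F, ← R.germ_G]
    refine (GermCat.germ_eq_iff _ _).2 fun s => ?_
    refine (GermRep.ext_comp _ (R.F l) s).trans
      (Filter.EventuallyEq.trans (Filter.Eventually.of_forall fun t => ?_)
        (GermRep.ext_comp _ (R.G l) s).symm)
    simp only [Function.comp, hπe]
    exact (t.2.1 l).2.2
  · intro Z z hz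
    choose ζ hζ using fun j => GermCat.exists_rep (z j)
    have hsol := R.eventually_mem_sol ζ (by simpa only [hζ] using hz)
    let Ψ : Z.toEmb.mfd → ∀ j, E.X j := fun x j => (ζ j).ext x
    obtain ⟨W, hW, hW'⟩ := exists_opens_interior fun x => (∀ j, x ∈ (ζ j).dom) ∧
      Ψ x ∈ R.sol ∧ ∃ s, Ψ x ∈ (c s).V
    -- Near S the tuple Ψ consists of solutions covered by slice charts; the value elsewhere is
    -- arbitrary.
    let h₀ : Z.toEmb.mfd → SliceSpace c := fun x =>
      if h : Ψ x ∈ R.sol ∧ ∃ s, Ψ x ∈ (c s).V then ⟨Ψ x, h⟩ else e₀ (Classical.arbitrary _)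
    have hh₀ : ∀ x ∈ W, (h₀ x).1 = Ψ x := fun x hx =>
      congrArg Subtype.val (dif_pos (hW x hx).2)
    have hΨ : ∀ s, Ψ (Z.toEmb.emb s) = E.base s := fun s => funext fun j => (ζ j).ext_emb s
    have hWemb : ∀ s, Z.toEmb.emb s ∈ W := fun s => by
      refine hW' _ ((Filter.eventually_all.2 fun j => (ζ j).dom_mem_nhds ((ζ j).mem_dom s)).and
        ((hsol s).and ?_))
      have hc : ContinuousAt Ψ (Z.toEmb.emb s) :=
        continuousAt_pi.2 fun j => ((ζ j).contMDiffAt_ext ((ζ j).mem_dom s)).continuousAt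
      have h1 := hc.tendsto
      rw [hΨ] at h1
      filter_upwards [h1 ((c s).isOpen_V.mem_nhds (hV s))] with x hx
      exact ⟨s, hx⟩
    let h : GermRep Z.toEmb T.toEmb := GermRep.ofSmoothOn h₀ W hWemb
      (fun x hx => SliceSpace.contMDiffAt_lift c fun j => by
        refine ((ζ j).contMDiffAt_ext ((hW x hx).1 j)).congr_of_eventuallyEq ?_
        filter_upwards [W.isOpen.mem_nhds hx] with y hy
        exact congrFun (hh₀ y hy) j)
      (fun s => Subtype.ext ((hh₀ _ (hWemb s)).trans (hΨ s)))
    refine ⟨h.germ, fun j => ?_⟩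
    rw [← hζ j]
    refine (GermCat.germ_eq_iff _ _).2 fun s => ?_
    refine (GermRep.ext_comp _ _ s).trans ?_
    have hhe : h.ext =ᶠ[𝓝 (Z.toEmb.emb s)] h₀ := GermRep.ext_ofSmoothOn _ _ _ _ _ s
    filter_upwards [hhe, W.isOpen.mem_nhds (hWemb s)] with x hx hxW
    rw [Function.comp, hx, hπe]
    exact congrFun (hh₀ x hxW) j
  · intro Z h h' hh
    obtain ⟨h, rfl⟩ := GermCat.exists_rep h
    obtain ⟨h', rfl⟩ := GermCat.exists_rep h'
    refine (GermCat.germ_eq_iff _ _).2 fun s => ?_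
    have h1 : ∀ j, ∀ᶠ x in 𝓝 (Z.toEmb.emb s), SliceSpace.proj c j (h.ext x) =
        SliceSpace.proj c j (h'.ext x) := fun j => by
      have h2 := (GermCat.germ_eq_iff _ _).1 (hh j) s
      have h3 := (GermRep.ext_comp _ _ s).symm.trans (h2.trans (GermRep.ext_comp _ _ s))
      filter_upwards [h3] with x hx
      simpa only [Function.comp, hπe] using hx
    filter_upwards [Filter.eventually_all.2 h1] with x hx
    exact Subtype.ext (funext hx)
  · intro s u hu
    obtain ⟨F, hF, hF'⟩ := htan s
    obtain ⟨k, rfl⟩ := hF.2 u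
    have h1 : ι s k = 0 := funext fun j => (hF' j k).symm.trans (hu j)
    have h2 : k = 0 := hι s (h1.trans (map_zero _).symm)
    exact (congrArg F h2).trans (map_zero F)
  · intro s v hv
    obtain ⟨F, hF, hF'⟩ := htan s
    obtain ⟨k, rfl⟩ := (hιr s v).1 hv
    exact ⟨F k, fun j => hF' j k⟩

end GermSystem

/-! ### The pretopology of germs of submersions -/

namespace GermSystem

variable {S : SmoothMfd.{u}}

/-- The equation `f = p` that defines a pullback. -/
def ofCospan {X Y U : GermCat S} (f : Y ⟶ X) (p : U ⟶ X) : GermSystem S Bool Unit where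
  M b := cond b U Y
  C _ := X
  a _ := false
  b _ := true
  f _ := f
  g _ := p

variable [Nonempty S.carrier] {X Y U : GermCat S} (f : Y ⟶ X) {p : U ⟶ X}

/-- A submersion p makes the linearized equation f - p independent, already by varying the point of
U; rank-nullity then gives the dimension of its kernel. -/
theorem nonempty_universalSolution_ofCospan (hp : submersionGerms S p) :
    Nonempty (ofCospan f p).UniversalSolution := by
  have hs : ∀ s, Function.Surjective ((ofCospan f p).tangentEq s) := fun s w => by
    obtain ⟨v, hv⟩ := (GermCat.submersionGerms_iff p).1 hp s (-w ())
    refine ⟨fun j => Bool.rec 0 v j, funext fun _ => ?_⟩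
    rw [tangentEq_apply]
    exact (congrArg₂ (· - ·) (map_zero (GermCat.tangent s f)) hv).trans
      ((zero_sub _).trans (neg_neg _))
  refine nonempty_universalSolution
    (Module.finrank ℝ (∀ j, Euc ((ofCospan f p).M j).dim) -
      Module.finrank ℝ (∀ l, Euc ((ofCospan f p).C l).dim)) (fun s => ?_) fun s => .inl (hs s)
  have h1 := LinearMap.finrank_range_add_finrank_ker ((ofCospan f p).tangentEq s).toLinearMap
  have h2 : LinearMap.range ((ofCospan f p).tangentEq s).toLinearMap = ⊤ :=
    LinearMap.range_eq_top.2 (hs s)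
  rw [h2, finrank_top] at h1
  omega

theorem UniversalSolution.hasPullback (u : (ofCospan f p).UniversalSolution) :
    Limits.HasPullback f p := by
  refine Limits.HasLimit.mk ⟨Limits.PullbackCone.mk (u.π false) (u.π true) (u.isSolution ()),
    Limits.PullbackCone.isLimitAux' _ fun c => ?_⟩
  let z : ∀ j, c.pt ⟶ (ofCospan f p).M j := fun j => Bool.rec c.fst c.snd j
  have h := u.exists_lift z fun _ => c.condition
  refine ⟨h.choose, h.choose_spec false, h.choose_spec true, fun {m} h1 h2 => ?_⟩
  refine u.hom_ext _ _ fun j => ?_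
  cases j
  · exact h1.trans (h.choose_spec false).symm
  · exact h2.trans (h.choose_spec true).symm

end GermSystem

section Pretopology

variable {S : SmoothMfd.{u}}

theorem isSingletonPretopology_of_nonempty [Nonempty S.carrier] :
    IsSingletonPretopology (submersionGerms S) where
  hasPullback f p hp :=
    (GermSystem.nonempty_universalSolution_ofCospan f hp).some.hasPullback f
  baseChange {X Y U P f p q g} hP hp := by
    have u := (GermSystem.nonempty_universalSolution_ofCospan f hp).some
    rw [GermCat.submersionGerms_iff] at hp ⊢
    intro s v
    obtain ⟨w, hw⟩ := hp s (GermCat.tangent s f v)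
    let z : ∀ j, Euc ((GermSystem.ofCospan f p).M j).dim := fun j => Bool.rec v w j
    obtain ⟨t, ht⟩ := u.exists_tangent s z
      (((GermSystem.ofCospan f p).tangentEq_eq_zero_iff s z).2 fun _ => hw.symm)
    -- The universal solution maps to the given pullback over Y, so tangent vectors of Y hit from
    -- the former are hit from the latter.
    obtain ⟨r, hr⟩ : ∃ r : u.T ⟶ P, r ≫ q = u.π false :=
      ⟨hP.lift (u.π false) (u.π true) (u.isSolution ()), hP.lift_fst _ _ _⟩
    have h1 : GermCat.tangent s (r ≫ q) t = v := hr ▸ ht false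
    rw [GermCat.tangent_comp] at h1
    exact ⟨_, h1⟩
  comp f g hf hg := by
    rw [GermCat.submersionGerms_iff] at hf hg ⊢
    intro s
    rw [GermCat.tangent_comp]
    exact (hg s).comp (hf s)
  iso f _ := by
    rw [GermCat.submersionGerms_iff]
    intro s v
    refine ⟨GermCat.tangent s (inv f) v, ?_⟩
    rw [← ContinuousLinearMap.comp_apply, ← GermCat.tangent_comp, IsIso.inv_hom_id,
      GermCat.tangent_id]
    rfl

/-! ### Germs at the empty manifold -/

namespace GermCat

variable [IsEmpty S.carrier] {A B : GermCat S}

/-- Any two representatives agree on the empty set, which is a neighbourhood of the empty manifold.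
-/
instance : Subsingleton (A ⟶ B) where
  allEq := by
    rintro ⟨f⟩ ⟨g⟩
    exact Quotient.sound ⟨⊥, isEmptyElim, bot_le, bot_le, fun _ h => h.elim⟩

/-- The representative with empty domain. -/
def emptyRep (A B : MfdEmb S) : GermRep A B where
  dom := ⊥
  mem_dom := isEmptyElim
  map x := x.2.elim
  smooth x := x.2.elim
  map_emb := isEmptyElim

theorem submersionGerms_of_isEmpty (φ : A ⟶ B) : submersionGerms S φ :=
  ⟨emptyRep _ _, Subsingleton.elim _ _, fun x => x.2.elim⟩

/-- Every cone of germs at the empty manifold is a limit cone. -/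
def isLimitOfIsEmpty {K : Type*} [Category K] {F : K ⥤ GermCat S} (c : Limits.Cone F) :
    Limits.IsLimit c where
  lift _ := (emptyRep _ _).germ
  fac _ _ := Subsingleton.elim _ _
  uniq _ _ _ := Subsingleton.elim _ _

end GermCat

theorem isSingletonPretopology_of_isEmpty [IsEmpty S.carrier] :
    IsSingletonPretopology (submersionGerms S) where
  hasPullback _ _ _ := Limits.HasLimit.mk ⟨Limits.PullbackCone.mk (𝟙 _)
    (GermCat.emptyRep _ _).germ (Subsingleton.elim _ _), GermCat.isLimitOfIsEmpty _⟩
  baseChange _ _ := GermCat.submersionGerms_of_isEmpty _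
  comp _ _ _ _ := GermCat.submersionGerms_of_isEmpty _
  iso _ _ := GermCat.submersionGerms_of_isEmpty _

theorem isKanObject_of_isEmpty [IsEmpty S.carrier] (X : SimplicialObject (GermCat S)) :
    IsKanObject (submersionGerms S) X := fun n _ i =>
  ⟨hornCone X n i, GermCat.isLimitOfIsEmpty _, GermCat.submersionGerms_of_isEmpty _⟩

end Pretopology

/-! ### Horns in simplicial vector spaces -/

/-- The faces and degeneracies of a simplicial vector space, indexed by natural numbers. -/
structure FaceSystem (V : ℕ → Type) [∀ n, AddCommGroup (V n)] [∀ n, Module ℝ (V n)] where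
  d : ∀ n, ℕ → V (n + 1) →ₗ[ℝ] V n
  s : ∀ n, ℕ → V n →ₗ[ℝ] V (n + 1)
  d_d : ∀ n i j, i ≤ j → j ≤ n + 1 → ∀ x, d n i (d (n + 1) (j + 1) x) = d n j (d (n + 1) i x)
  d_s_self : ∀ n i, i ≤ n → ∀ x, d n i (s n i x) = x
  d_s_succ : ∀ n i, i ≤ n → ∀ x, d n (i + 1) (s n i x) = x
  d_s_lt : ∀ n i j, i ≤ j → j ≤ n → ∀ x, d (n + 1) i (s (n + 1) (j + 1) x) = s n j (d n i x)
  d_s_gt : ∀ n i j, j < i → i ≤ n + 1 → ∀ x,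
    d (n + 1) (i + 1) (s (n + 1) j x) = s n j (d n i x)

/-- Rank-nullity for the restriction of f to A, with image B and kernel A'. -/
theorem finrank_add_finrank_of_map {V W : Type*} [AddCommGroup V] [Module ℝ V] [AddCommGroup W]
    [Module ℝ W] [FiniteDimensional ℝ V] (f : V →ₗ[ℝ] W) (A A' : Submodule ℝ V)
    (B : Submodule ℝ W) (h1 : ∀ x ∈ A, f x ∈ B) (h2 : ∀ y ∈ B, ∃ x ∈ A, f x = y)
    (h3 : ∀ x, x ∈ A' ↔ x ∈ A ∧ f x = 0) :
    Module.finrank ℝ B + Module.finrank ℝ A' = Module.finrank ℝ A := by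
  have hB : B = A.map f := by
    ext y
    exact ⟨fun hy => h2 y hy, by rintro ⟨x, hx, rfl⟩; exact h1 x hx⟩
  have hA : A' ≤ A := fun x hx => ((h3 x).1 hx).1
  have hr : LinearMap.range (f.domRestrict A) = B := by
    rw [hB, LinearMap.range_domRestrict]
  have hk : (LinearMap.ker (f.domRestrict A)).map A.subtype = A' := by
    ext x
    constructor
    · rintro ⟨y, hy, rfl⟩
      exact (h3 _).2 ⟨y.2, hy⟩
    · intro hx
      exact ⟨⟨x, hA hx⟩, ((h3 x).1 hx).2, rfl⟩
  have h4 := LinearMap.finrank_range_add_finrank_ker (f.domRestrict A)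
  rw [hr] at h4
  rw [← h4, ← hk, Submodule.finrank_map_subtype_eq]

namespace FaceSystem

variable {V : ℕ → Type} [∀ n, AddCommGroup (V n)] [∀ n, Module ℝ (V n)] (F : FaceSystem V)

/-- The vectors whose first `a` and last `b` faces vanish. -/
def K (n a b : ℕ) : Submodule ℝ (V n) :=
  Nat.casesOn (motive := fun n => Submodule ℝ (V n)) n ⊤ fun n =>
    { carrier := { x | ∀ j ≤ n + 1, (j < a ∨ n + 1 < j + b) → F.d n j x = 0 }
      add_mem' := fun hx hy j h h' => by rw [map_add, hx j h h', hy j h h', add_zero]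
      zero_mem' := fun _ _ _ => map_zero _
      smul_mem' := fun r x hx j h h' => by rw [map_smul, hx j h h', smul_zero] }

theorem mem_K_succ {n a b : ℕ} {x : V (n + 1)} :
    x ∈ F.K (n + 1) a b ↔ ∀ j ≤ n + 1, (j < a ∨ n + 1 < j + b) → F.d n j x = 0 := Iff.rfl

variable [∀ n, FiniteDimensional ℝ (V n)]

/-- The face `d a` has the section `s a`, and the simplicial identities show that both maps preserve
the vanishing of the first a faces. -/
theorem finrank_K_first {n a : ℕ} (h : a ≤ n) :
    Module.finrank ℝ (F.K n a 0) + Module.finrank ℝ (F.K (n + 1) (a + 1) 0) =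
      Module.finrank ℝ (F.K (n + 1) a 0) := by
  refine finrank_add_finrank_of_map (F.d n a) _ _ _ (fun x hx => ?_) (fun y hy => ?_) fun x => ?_
  · cases n with
    | zero => trivial
    | succ n =>
      rw [mem_K_succ] at hx ⊢
      intro j hj hja
      obtain ⟨a, rfl⟩ : ∃ a', a = a' + 1 := ⟨a - 1, by omega⟩
      rw [F.d_d n j a (by omega) (by omega), hx j (by omega) (by omega), map_zero]
  · refine ⟨F.s n a y, ?_, F.d_s_self n a h y⟩
    rw [mem_K_succ]
    intro j hj hja
    obtain ⟨a, rfl⟩ : ∃ a', a = a' + 1 := ⟨a - 1, by omega⟩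
    obtain ⟨n, rfl⟩ : ∃ n', n = n' + 1 := ⟨n - 1, by omega⟩
    rw [mem_K_succ] at hy
    rw [F.d_s_lt n j a (by omega) (by omega), hy j (by omega) (by omega), map_zero]
  · simp only [mem_K_succ]
    constructor
    · intro hx
      exact ⟨fun j hj hj' => hx j hj (by omega), hx a (by omega) (by omega)⟩
    · rintro ⟨hx, hx'⟩ j hj hj'
      rcases Nat.lt_or_ge j a with h1 | h1
      · exact hx j hj (by omega)
      · obtain rfl : j = a := by omega
        exact hx'

/-- The next face from the end is d with index n + 1 - b, with section s of index n - b. The bound a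
+ b ≤ n keeps this degeneracy clear of the first a faces. -/
theorem finrank_K_last {n a b : ℕ} (h : a + b ≤ n) :
    Module.finrank ℝ (F.K n a b) + Module.finrank ℝ (F.K (n + 1) a (b + 1)) =
      Module.finrank ℝ (F.K (n + 1) a b) := by
  obtain ⟨k, hk⟩ : ∃ k, k + b = n := ⟨n - b, by omega⟩
  refine finrank_add_finrank_of_map (F.d n (k + 1)) _ _ _ (fun x hx => ?_) (fun y hy => ?_)
    fun x => ?_
  · cases n with
    | zero => trivial
    | succ n =>
      rw [mem_K_succ] at hx ⊢
      intro j hj hja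
      rcases Nat.lt_or_ge k j with h1 | h1
      · rw [← F.d_d n (k + 1) j (by omega) (by omega), hx (j + 1) (by omega) (by omega), map_zero]
      · rw [F.d_d n j k (by omega) (by omega), hx j (by omega) (by omega), map_zero]
  · refine ⟨F.s n k y, ?_, F.d_s_succ n k (by omega) y⟩
    rw [mem_K_succ]
    intro j hj hja
    obtain ⟨n, rfl⟩ : ∃ n', n = n' + 1 := ⟨n - 1, by omega⟩
    rw [mem_K_succ] at hy
    rcases Nat.lt_or_ge j a with h1 | h1
    · obtain ⟨k, rfl⟩ : ∃ k', k = k' + 1 := ⟨k - 1, by omega⟩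
      rw [F.d_s_lt n j k (by omega) (by omega), hy j (by omega) (by omega), map_zero]
    · obtain ⟨j, rfl⟩ : ∃ j', j = j' + 1 := ⟨j - 1, by omega⟩
      rw [F.d_s_gt n j k (by omega) (by omega), hy j (by omega) (by omega), map_zero]
  · simp only [mem_K_succ]
    constructor
    · intro hx
      exact ⟨fun j hj hj' => hx j hj (by omega), hx (k + 1) (by omega) (by omega)⟩
    · rintro ⟨hx, hx'⟩ j hj hj'
      by_cases h1 : j = k + 1
      · rw [h1]
        exact hx'
      · exact hx j hj (by omega)

/-- The dimensions of the spaces `K` only depend on the dimensions of the vector spaces. -/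
theorem finrank_K_eq (F' : FaceSystem V) (n : ℕ) : ∀ a b : ℕ, a + b ≤ n →
    Module.finrank ℝ (F.K n a b) = Module.finrank ℝ (F'.K n a b) := by
  induction n with
  | zero => exact fun _ _ _ => rfl
  | succ n ih =>
    intro a b
    induction b with
    | zero =>
      intro ha
      induction a with
      | zero =>
        have h1 : ∀ F : FaceSystem V, F.K (n + 1) 0 0 = ⊤ := fun F =>
          top_le_iff.1 fun x _ j _ hj' => by omega
        rw [h1 F, h1 F']
      | succ a iha =>
        have h1 := F.finrank_K_first (show a ≤ n by omega)
        have h2 := F'.finrank_K_first (show a ≤ n by omega)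
        have h3 := iha (by omega)
        have h4 := ih a 0 (by omega)
        omega
    | succ b ihb =>
      intro hab
      have h1 := F.finrank_K_last (show a + b ≤ n by omega)
      have h2 := F'.finrank_K_last (show a + b ≤ n by omega)
      have h3 := ihb (by omega)
      have h4 := ih a b (by omega)
      omega

omit [∀ n, FiniteDimensional ℝ (V n)] in
/-- Compatible faces of a horn of dimension at least two have a common filler. -/
theorem exists_filler {m i : ℕ} (hi : i ≤ m + 2) (v : ℕ → V (m + 1))
    (hv : ∀ j k, j ≤ k → k ≤ m + 1 → j ≠ i → k + 1 ≠ i → F.d m j (v (k + 1)) = F.d m k (v j)) :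
    ∃ w, ∀ j ≤ m + 2, j ≠ i → F.d (m + 1) j w = v j := by
  have first : ∀ a ≤ i, ∃ w, ∀ j < a, F.d (m + 1) j w = v j := by
    intro a
    induction a with
    | zero => exact fun _ => ⟨0, fun j hj => by omega⟩
    | succ a ih =>
      intro ha
      obtain ⟨w, hw⟩ := ih (by omega)
      -- The degeneracy of the error corrects face a. By compatibility the lower faces of the error
      -- vanish, so the faces already matched are not disturbed.
      refine ⟨w + F.s (m + 1) a (v a - F.d (m + 1) a w), fun j hj => ?_⟩
      rw [map_add]
      rcases Nat.lt_or_ge j a with h1 | h1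
      · obtain ⟨a, rfl⟩ : ∃ a', a = a' + 1 := ⟨a - 1, by omega⟩
        rw [F.d_s_lt m j a (by omega) (by omega), map_sub, hv j a (by omega) (by omega) (by omega)
          (by omega), F.d_d m j a (by omega) (by omega), hw j h1, sub_self, map_zero, add_zero]
      · obtain rfl : j = a := by omega
        rw [F.d_s_self _ _ (by omega)]
        abel
  have last : ∀ b ≤ m + 2 - i, ∃ w, ∀ j ≤ m + 2, (j < i ∨ m + 2 < j + b) →
      F.d (m + 1) j w = v j := by
    intro b
    induction b with
    | zero =>
      intro _
      obtain ⟨w, hw⟩ := first i le_rfl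
      exact ⟨w, fun j hj hj' => hw j (by omega)⟩
    | succ b ih =>
      intro hb
      obtain ⟨w, hw⟩ := ih (by omega)
      obtain ⟨k, hk⟩ : ∃ k, k + 1 + b = m + 2 := ⟨m + 1 - b, by omega⟩
      -- Faces above i are corrected from the top down. As k ≥ i, using the degeneracy whose upper
      -- face is k + 1 disturbs neither the faces below i nor those above k + 1.
      refine ⟨w + F.s (m + 1) k (v (k + 1) - F.d (m + 1) (k + 1) w), fun j hj hj' => ?_⟩
      rw [map_add]
      by_cases h1 : j = k + 1
      · rw [h1, F.d_s_succ _ _ (by omega)]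
        abel
      rcases Nat.lt_or_ge j i with h2 | h2
      · obtain ⟨k, rfl⟩ : ∃ k', k = k' + 1 := ⟨k - 1, by omega⟩
        rw [F.d_s_lt m j k (by omega) (by omega), map_sub, hv j (k + 1) (by omega) (by omega)
          (by omega) (by omega), F.d_d m j (k + 1) (by omega) (by omega), hw j hj (by omega),
          sub_self, map_zero, add_zero]
      · obtain ⟨j, rfl⟩ : ∃ j', j = j' + 1 := ⟨j - 1, by omega⟩
        rw [F.d_s_gt m j k (by omega) (by omega), map_sub, ← hv (k + 1) j (by omega) (by omega)
          (by omega) (by omega), ← F.d_d m (k + 1) j (by omega) (by omega),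
          hw (j + 1) hj (by omega), sub_self, map_zero, add_zero]
  obtain ⟨w, hw⟩ := last _ le_rfl
  exact ⟨w, fun j hj hj' => hw j hj (by omega)⟩

end FaceSystem

/-! ### Horn spaces of simplicial germs -/

section Horn

variable {S : SmoothMfd.{u}}

/-- The dimensions of the manifolds of a simplicial germ. -/
abbrev simplexDim (Y : SimplicialObject (GermCat S)) (n : ℕ) : ℕ := (Y _⦋n⦌).dim

/-- The simplicial vector space of tangent spaces of a simplicial germ at a point of `S`. -/
noncomputable def tangentFaceSystem [Nonempty S.carrier] (Y : SimplicialObject (GermCat S))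
    (s : S) : FaceSystem fun n => Euc (simplexDim Y n) where
  d n j := if h : j < n + 2 then (GermCat.tangent s (Y.δ ⟨j, h⟩)).toLinearMap else 0
  s n j := if h : j < n + 1 then (GermCat.tangent s (Y.σ ⟨j, h⟩)).toLinearMap else 0
  d_d n i j hij hj x := by
    rw [dif_pos (by omega), dif_pos (by omega), dif_pos (by omega), dif_pos (by omega)]
    have h := congrArg (fun φ => GermCat.tangent s φ x)
      (Y.δ_comp_δ (n := n) (i := ⟨i, by omega⟩) (j := ⟨j, by omega⟩) hij)
    simpa only [GermCat.tangent_comp] using! h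
  d_s_self n i hi x := by
    rw [dif_pos (by omega), dif_pos (by omega)]
    have h := congrArg (fun φ => GermCat.tangent s φ x)
      (Y.δ_comp_σ_self (n := n) (i := ⟨i, by omega⟩))
    simpa only [GermCat.tangent_comp, GermCat.tangent_id] using! h
  d_s_succ n i hi x := by
    rw [dif_pos (by omega), dif_pos (by omega)]
    have h := congrArg (fun φ => GermCat.tangent s φ x)
      (Y.δ_comp_σ_succ (n := n) (i := ⟨i, by omega⟩))
    simpa only [GermCat.tangent_comp, GermCat.tangent_id] using! h
  d_s_lt n i j hij hj x := by
    rw [dif_pos (by omega), dif_pos (by omega), dif_pos (by omega), dif_pos (by omega)]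
    have h := congrArg (fun φ => GermCat.tangent s φ x)
      (Y.δ_comp_σ_of_le (n := n) (i := ⟨i, by omega⟩) (j := ⟨j, by omega⟩) hij)
    simpa only [GermCat.tangent_comp] using! h
  d_s_gt n i j hij hj x := by
    rw [dif_pos (by omega), dif_pos (by omega), dif_pos (by omega), dif_pos (by omega)]
    have h := congrArg (fun φ => GermCat.tangent s φ x)
      (Y.δ_comp_σ_of_gt (n := n) (i := ⟨i, by omega⟩) (j := ⟨j, by omega⟩) hij)
    simpa only [GermCat.tangent_comp] using! h

theorem tangentFaceSystem_d [Nonempty S.carrier] (Y : SimplicialObject (GermCat S)) (s : S)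
    {n j : ℕ} (h : j < n + 2) (x : Euc (simplexDim Y (n + 1))) :
    (tangentFaceSystem Y s).d n j x = GermCat.tangent s (Y.δ ⟨j, h⟩) x :=
  LinearMap.congr_fun (dif_pos h) x

/-- The faces of the `i`-th horn. -/
abbrev HornFace {m : ℕ} (i : Fin (m + 2)) : Type := { j : Fin (m + 2) // j ≠ i }

/-- Two faces of the `i`-th horn with a common simplex. -/
structure HornOverlap {m : ℕ} (i : Fin (m + 2)) : Type where
  j : HornFace i
  k : HornFace i
  -- For m = 0 the truncated subtraction gives ⦋0⦌; the horn then has a single face, and the only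
  -- overlap is that face with itself, a trivial equation.
  θ : ⦋m - 1⦌ ⟶ ⦋m⦌
  τ : ⦋m - 1⦌ ⟶ ⦋m⦌
  w : θ ≫ SimplexCategory.δ j.1 = τ ≫ SimplexCategory.δ k.1

instance {m : ℕ} (i : Fin (m + 2)) : Finite (HornOverlap i) :=
  Finite.of_injective (fun o : HornOverlap i => (o.j, o.k, o.θ, o.τ)) fun o o' h => by
    cases o
    cases o'
    simp only [Prod.mk.injEq] at h
    obtain ⟨rfl, rfl, rfl, rfl⟩ := h
    rfl

variable (Y : SimplicialObject (GermCat S)) {m : ℕ} (i : Fin (m + 2))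

/-- The equations that define the horn space. -/
def hornSystem : GermSystem S (HornFace i) (HornOverlap i) where
  M _ := Y _⦋m⦌
  C _ := Y _⦋m - 1⦌
  a o := o.j
  b o := o.k
  f o := Y.map o.θ.op
  g o := Y.map o.τ.op

theorem isSolution_faces : (hornSystem Y i).IsSolution (A := Y _⦋m + 1⦌) fun j => Y.δ j.1 := by
  intro o
  have h := congrArg (fun χ => Y.map χ.op) o.w
  simpa only [op_comp, Y.map_comp] using! h

variable {Y i}

/-- A simplex lying in two distinct faces factors through their intersection, a face of codimension
two, where the equations of the system apply. -/
theorem hornSystem_comp_eq_of_lt {A : GermCat S} {φ : HornFace i → (A ⟶ Y _⦋m⦌)}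
    (hφ : (hornSystem Y i).IsSolution φ) {Δ : SimplexCategory} {j k : HornFace i} (hjk : j.1 < k.1)
    (θ τ : Δ ⟶ ⦋m⦌) (h : θ ≫ SimplexCategory.δ j.1 = τ ≫ SimplexCategory.δ k.1) :
    φ j ≫ Y.map θ.op = φ k ≫ Y.map τ.op := by
  obtain ⟨j, hj⟩ := j
  obtain ⟨k, hk⟩ := k
  obtain ⟨j, rfl⟩ : ∃ j' : Fin (m + 1), j = j'.castSucc :=
    ⟨⟨j, by have := k.2; simp only [Fin.lt_def] at hjk; omega⟩, rfl⟩
  obtain ⟨k, rfl⟩ : ∃ k' : Fin (m + 1), k = k'.succ :=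
    Fin.exists_succ_eq.2 (Fin.ne_zero_of_lt hjk) |>.imp fun _ h => h.symm
  have hjk' : j ≤ k := Nat.lt_succ_iff.1 hjk
  -- The j-th coface sends the vertex k to k + 1, which the other face omits.
  have hmiss : ∀ x, SimplexCategory.Hom.toOrderHom θ x ≠ k := by
    intro x hx
    have h1 := congrArg (fun χ => SimplexCategory.Hom.toOrderHom χ x) h
    have h2 : j.castSucc.succAbove (SimplexCategory.Hom.toOrderHom θ x) =
      k.succ.succAbove (SimplexCategory.Hom.toOrderHom τ x) := h1
    rw [hx, Fin.succAbove_of_le_castSucc _ _ (Fin.castSucc_le_castSucc_iff.2 hjk')] at h2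
    exact Fin.succAbove_ne _ _ h2.symm
  cases m with
  -- The two faces of an edge are disjoint.
  | zero => exact (hmiss 0 (Subsingleton.elim (α := Fin 1) _ _)).elim
  | succ m =>
    obtain ⟨ρ, rfl⟩ := SimplexCategory.eq_comp_δ_of_not_surjective' θ k hmiss
    have hδ := SimplexCategory.δ_comp_δ hjk'
    have hτ : τ = ρ ≫ SimplexCategory.δ j := by
      rw [← cancel_mono (SimplexCategory.δ k.succ), ← h, Category.assoc, Category.assoc, hδ]
    subst hτ
    have h1 := hφ ⟨⟨_, hj⟩, ⟨_, hk⟩, SimplexCategory.δ k, SimplexCategory.δ j, hδ.symm⟩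
    have h2 : φ ⟨_, hj⟩ ≫ Y.map (SimplexCategory.δ k).op =
      φ ⟨_, hk⟩ ≫ Y.map (SimplexCategory.δ j).op := h1
    rw [op_comp, op_comp, Y.map_comp, Y.map_comp, reassoc_of% h2]

theorem hornSystem_comp_eq {A : GermCat S} {φ : HornFace i → (A ⟶ Y _⦋m⦌)}
    (hφ : (hornSystem Y i).IsSolution φ) {Δ : SimplexCategory} (j k : HornFace i)
    (θ τ : Δ ⟶ ⦋m⦌) (h : θ ≫ SimplexCategory.δ j.1 = τ ≫ SimplexCategory.δ k.1) :
    φ j ≫ Y.map θ.op = φ k ≫ Y.map τ.op := by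
  rcases lt_trichotomy j.1 k.1 with hjk | hjk | hjk
  · exact hornSystem_comp_eq_of_lt hφ hjk θ τ h
  · obtain rfl : j = k := Subtype.ext hjk
    rw [(cancel_mono _).1 h]
  · exact (hornSystem_comp_eq_of_lt hφ hjk τ θ h.symm).symm

/-- A simplex of the horn misses some vertex other than i, hence lies in the opposite face. -/
theorem exists_face_of_mem_horn {k : SimplexCategoryᵒᵖ}
    (x : (Λ[m + 1, i] : SSet.{0}).obj k) : ∃ (j : HornFace i) (θ : k.unop ⟶ ⦋m⦌),
      SSet.stdSimplex.objEquiv x.1 = θ ≫ SimplexCategory.δ j.1 := by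
  obtain ⟨j, hj, hx⟩ := (SSet.mem_horn_iff_notMem_range (d := k.unop.len) x.1 i).1 x.2
  obtain ⟨θ, hθ⟩ := SimplexCategory.eq_comp_δ_of_not_surjective'
    (SSet.stdSimplex.objEquiv x.1) j fun y hy => hx ⟨y, hy⟩
  exact ⟨⟨j, hj⟩, θ, hθ⟩

/-! ### Linear horn filling and the dimension of horn spaces -/

variable [Nonempty S.carrier]

/-- A solution of the linearized equations of a horn comes from a tangent vector of the
manifold of simplices. -/
theorem exists_tangent_filler (s : S) (v : HornFace i → Euc (simplexDim Y m))
    (hv : (hornSystem Y i).tangentEq s v = 0) :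
    ∃ w : Euc (simplexDim Y (m + 1)), ∀ j : HornFace i, GermCat.tangent s (Y.δ j.1) w = v j := by
  replace hv := ((hornSystem Y i).tangentEq_eq_zero_iff s v).1 hv
  let F := tangentFaceSystem Y s
  -- Extension by zero to all natural indices, including the missing face i.
  let v' : ℕ → Euc (simplexDim Y m) := fun j =>
    if h : ∃ h : j < m + 2, (⟨j, h⟩ : Fin (m + 2)) ≠ i then v ⟨_, h.choose_spec⟩ else 0
  have hv' : ∀ j : HornFace i, v' j.1 = v j := fun j => dif_pos ⟨j.1.2, j.2⟩
  suffices h : ∃ w, ∀ j ≤ m + 1, j ≠ i.1 → F.d m j w = v' j by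
    obtain ⟨w, hw⟩ := h
    refine ⟨w, fun j => ?_⟩
    rw [← hv' j, ← hw j.1 (by omega) (fun h => j.2 (Fin.ext h)), tangentFaceSystem_d]
  cases m with
  | zero =>
    -- A one-dimensional horn has no compatibility condition; a degenerate vector fills it.
    obtain ⟨j, hj⟩ := exists_ne i
    refine ⟨F.s 0 0 (v' j), fun k hk hki => ?_⟩
    have hji := Fin.val_ne_of_ne hj
    obtain rfl : k = j := by omega
    obtain hk' | hk' : j.1 = 0 ∨ j.1 = 1 := by omega
    · rw [hk']
      exact F.d_s_self 0 0 le_rfl _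
    · rw [hk']
      exact F.d_s_succ 0 0 le_rfl _
  | succ m =>
    refine F.exists_filler (i := i.1) (by omega) v' fun j k hjk hk hji hki => ?_
    let k' : HornFace i := ⟨⟨k + 1, by omega⟩, fun h => hki (congrArg Fin.val h)⟩
    let j' : HornFace i := ⟨⟨j, by omega⟩, fun h => hji (congrArg Fin.val h)⟩
    have h1 := hv ⟨k', j', SimplexCategory.δ ⟨j, by omega⟩, SimplexCategory.δ ⟨k, by omega⟩,
      SimplexCategory.δ_comp_δ (i := ⟨j, by omega⟩) (j := ⟨k, by omega⟩) hjk⟩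
    rw [tangentFaceSystem_d Y s (by omega), tangentFaceSystem_d Y s (by omega)]
    rw [show v' (k + 1) = v k' from hv' k', show v' j = v j' from hv' j']
    exact h1

/-- Rank-nullity for the tuple of faces other than the i-th: linear filling makes it surjective onto
the solution space, and its kernel is a space `K`. -/
theorem finrank_ker_hornSystem (s : S) :
    Module.finrank ℝ (LinearMap.ker ((hornSystem Y i).tangentEq s).toLinearMap) +
      Module.finrank ℝ ((tangentFaceSystem Y s).K (m + 1) i.1 (m + 1 - i.1)) =
      simplexDim Y (m + 1) := by
  let D : Euc (simplexDim Y (m + 1)) →ₗ[ℝ] (HornFace i → Euc (simplexDim Y m)) :=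
    LinearMap.pi fun j => (GermCat.tangent s (Y.δ j.1)).toLinearMap
  refine (finrank_add_finrank_of_map D ⊤ _ _ (fun x _ => ?_) (fun y hy => ?_) fun x => ?_).trans ?_
  · exact (isSolution_faces Y i).tangentEq_eq_zero s x
  · obtain ⟨w, hw⟩ := exists_tangent_filler s y hy
    exact ⟨w, trivial, funext hw⟩
  · rw [FaceSystem.mem_K_succ]
    constructor
    · intro h
      refine ⟨trivial, funext fun j => ?_⟩
      have h1 := h j.1 (by omega) (by have := Fin.val_ne_of_ne j.2; omega)
      rwa [tangentFaceSystem_d] at h1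
    · rintro ⟨-, h⟩ j hj hj'
      have h1 := congrFun h ⟨⟨j, by omega⟩, fun h => by
        have := congrArg Fin.val h
        simp only at this
        omega⟩
      rw [tangentFaceSystem_d Y s (by omega)]
      exact h1
  · rw [finrank_top, finrank_euclideanSpace_fin]

-- Regularity is of the second kind, with the (m + 1)-simplices as family of solutions. The kernel
-- dimensions at two points agree because their face systems live on vector spaces of the same
-- dimensions.
variable (Y i) in
theorem nonempty_universalSolution_horn : Nonempty (hornSystem Y i).UniversalSolution := by
  have : Nontrivial (Fin (m + 2)) := inferInstance
  obtain ⟨j, hj⟩ := exists_ne i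
  have : Nonempty (HornFace i) := ⟨⟨j, hj⟩⟩
  have s₀ : S := Classical.arbitrary _
  refine GermSystem.nonempty_universalSolution
    (Module.finrank ℝ (LinearMap.ker ((hornSystem Y i).tangentEq s₀).toLinearMap)) (fun s => ?_)
    fun s => .inr ⟨Y _⦋m + 1⦌, _, isSolution_faces Y i, exists_tangent_filler s⟩
  have h1 := finrank_ker_hornSystem (Y := Y) (i := i) s
  have h2 := finrank_ker_hornSystem (Y := Y) (i := i) s₀
  have h3 := (tangentFaceSystem Y s).finrank_K_eq (tangentFaceSystem Y s₀) (m + 1) i.1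
    (m + 1 - i.1) (by omega)
  omega

/-! ### The horn space as a weighted limit -/

/-- The projections of a universal solution of the equations of a horn to its faces. -/
def hornProj (U : (hornSystem Y i).UniversalSolution) (j : HornFace i) : U.T ⟶ Y _⦋m⦌ := U.π j

/-- The weighted cone given by a universal solution of the equations of a horn. -/
noncomputable def hornSpaceCone (U : (hornSystem Y i).UniversalSolution) :
    Limits.WeightedCone (Λ[m + 1, i] : SSet.{0}) Y :=
  Limits.WeightedCone.mk U.T (fun _ x => hornProj U (exists_face_of_mem_horn x).choose ≫
    Y.map (exists_face_of_mem_horn x).choose_spec.choose.op) <| by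
    intro k l x f
    rw [Category.assoc, ← Y.map_comp]
    refine hornSystem_comp_eq U.isSolution _ _ (f.unop ≫ _) _ ?_
    exact (Category.assoc _ _ _).trans ((congrArg (f.unop ≫ ·)
      (exists_face_of_mem_horn x).choose_spec.choose_spec.symm).trans
      (exists_face_of_mem_horn ((Λ[m + 1, i] : SSet.{0}).map f x)).choose_spec.choose_spec)

/-- The cone is independent of the choice of a face containing each simplex. -/
theorem hornSpaceCone_π (U : (hornSystem Y i).UniversalSolution) {k : SimplexCategoryᵒᵖ}
    (x : (Λ[m + 1, i] : SSet.{0}).obj k) (j : HornFace i) (θ : k.unop ⟶ ⦋m⦌)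
    (h : SSet.stdSimplex.objEquiv x.1 = θ ≫ SimplexCategory.δ j.1) :
    (hornSpaceCone U).π x = hornProj U j ≫ Y.map θ.op :=
  hornSystem_comp_eq U.isSolution _ _ _ _
    ((exists_face_of_mem_horn x).choose_spec.choose_spec.symm.trans h)

theorem hornSpaceCone_face (U : (hornSystem Y i).UniversalSolution) (j : HornFace i) :
    (hornSpaceCone U).π (SSet.horn.face i j.1 j.2) = hornProj U j := by
  rw [hornSpaceCone_π U _ j (𝟙 _) (Category.id_comp _).symm, op_id, Y.map_id, Category.comp_id]

-- The faces generate the horn, so they determine every weighted cone.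
omit [Nonempty S.carrier] in
theorem weightedCone_π_eq (c : Limits.WeightedCone (Λ[m + 1, i] : SSet.{0}) Y)
    {k : SimplexCategoryᵒᵖ} (x : (Λ[m + 1, i] : SSet.{0}).obj k) (j : HornFace i)
    (θ : k.unop ⟶ ⦋m⦌) (h : SSet.stdSimplex.objEquiv x.1 = θ ≫ SimplexCategory.δ j.1) :
    c.π x = c.π (SSet.horn.face i j.1 j.2) ≫ Y.map θ.op := by
  rw [Limits.WeightedCone.w]
  congr 1
  exact Subtype.ext (SSet.stdSimplex.objEquiv.injective h)

omit [Nonempty S.carrier] in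
theorem isSolution_weightedCone (c : Limits.WeightedCone (Λ[m + 1, i] : SSet.{0}) Y) :
    (hornSystem Y i).IsSolution fun j => c.π (SSet.horn.face i j.1 j.2) := by
  intro o
  exact (weightedCone_π_eq c (((Λ[m + 1, i] : SSet.{0})).map o.θ.op
    (SSet.horn.face i o.j.1 o.j.2)) o.j o.θ rfl).symm.trans
    (weightedCone_π_eq c _ o.k o.τ o.w)

/-- The cone given by a universal solution of the equations of a horn is a limit cone. -/
noncomputable def isLimitHornSpaceCone (U : (hornSystem Y i).UniversalSolution) :
    (hornSpaceCone U).IsLimit where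
  lift c := (U.exists_lift _ (isSolution_weightedCone c)).choose
  fac c x := by
    have h := (U.exists_lift _ (isSolution_weightedCone c)).choose_spec
    obtain ⟨j, θ, hθ⟩ := exists_face_of_mem_horn x.2
    change (U.exists_lift _ (isSolution_weightedCone c)).choose ≫ (hornSpaceCone U).π x.2 =
      Limits.WeightedCone.π c x.2
    rw [hornSpaceCone_π U x.2 j θ hθ, weightedCone_π_eq c x.2 j θ hθ, ← h j]
    exact (Category.assoc _ _ _).symm
  uniq c f hf := by
    have h := (U.exists_lift _ (isSolution_weightedCone c)).choose_spec
    refine U.hom_ext _ _ fun j => ((h j).trans ?_).symm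
    exact (hf _).symm.trans (congrArg (f ≫ ·) (hornSpaceCone_face U j))

/-- Simplicial objects in the category of germs are Kan. -/
theorem isKanObject_of_nonempty (Y : SimplicialObject (GermCat S)) :
    IsKanObject (submersionGerms S) Y := by
  intro n hn i
  obtain ⟨m, rfl⟩ : ∃ m, n = m + 1 := ⟨n - 1, by omega⟩
  obtain ⟨U⟩ := nonempty_universalSolution_horn Y i
  refine ⟨hornSpaceCone U, isLimitHornSpaceCone U, U.submersionGerms _ fun s v hv => ?_⟩
  -- Linear filling is used a second time, now for surjectivity of the tangent maps of the horn
  -- projection.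
  obtain ⟨w, hw⟩ := exists_tangent_filler s v hv
  refine ⟨w, fun j => ?_⟩
  let p := Limits.IsLimit.lift (isLimitHornSpaceCone U) (hornCone Y (m + 1) i)
  have h : p ≫ U.π j = Y.δ j.1 :=
    (congrArg (p ≫ ·) (hornSpaceCone_face U j)).symm.trans
      (Limits.IsLimit.fac (isLimitHornSpaceCone U) _ _)
  exact (congrArg (fun χ => GermCat.tangent s χ w) h).trans (hw j)

end Horn

theorem mainTheorem3 (X : SimplicialMfd.{u}) :
    IsSingletonPretopology (submersionGerms (X _⦋0⦌)) ∧
      IsKanObject (submersionGerms (X _⦋0⦌)) X.germ := by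
  cases isEmpty_or_nonempty (X _⦋0⦌).carrier
  · exact ⟨isSingletonPretopology_of_isEmpty, isKanObject_of_isEmpty _⟩
  · exact ⟨isSingletonPretopology_of_nonempty, isKanObject_of_nonempty _⟩
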